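/- Let $n,m\ge 1$ be integers, $T^n=(\mathbb R/\mathbb Z)^n$ with Lebesgue measure of total mass one, and for $f\in L^2(T^n)$ (complex valued) let $c_a(f)=\int_{T^n} f(x)e^{-2\pi i\langle a,x\rangle}\,dx$, $a\in\mathbb Z^n$. Let $H^m(T^n)$ be the space of $f\in L^2(T^n)$ whose weak derivatives $D^\alpha f$, $|\alpha|\le m$, lie in $L^2(T^n)$, with either of the two equivalent norms (i) $\|f\|^2=\sum_{|\alpha|\le m}\|D^\alpha f\|_{L^2}^2$, and then put $w_a=\sum_{|\alpha|\le m}\prod_{i=1}^n(2\pi a_i)^{2\alpha_i}$; (ii) $\|f\|^2=\sum_{a\in\mathbb Z^n}w_a|c_a(f)|^2$ with $w_a=(1+\langle a,a\rangle)^m$ (in both cases $\|f\|^2=\sum_a w_a|c_a(f)|^2$). Let $B=\{f\in H^m(T^n):\|f\|\le 1\}$, with the topology and the Borel sets of $L^2(T^n)$. For a finite family with repetitions (multiset) $\mathbf a$ of elements of $\mathbb Z^n$ put $m_{\mathbf a}(f)=\prod_{a\in\mathbf a}c_a(f)$. Given a tuple $A=(\mathbf a_1,\dots,\mathbf a_N)$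 of such families, the Sobolev moment cone is $$C(A)=\Big\{\Big(\int_B m_{\mathbf a_k}\,d\mu\Big)_{k=1}^N:\ \mu\text{ a nonnegative Radon measure supported on }B\Big\}\subset\mathbb C^N.$$ Let $\mathbb C[c,\bar c]$ be the ring of complex polynomials in the countably many variables $c_a,\bar c_a$ ($a\in\mathbb Z^n$), and let $q\mapsto q^*$ conjugate the coefficients and exchange $c_a$ with $\bar c_a$. Let $\mathbb C[c,\bar c]_{r,\rho}$ be the set of polynomials of degree at most $r$ that involve only variables with $\max_i|a_i|\le\rho$, let $\Sigma_{r,\rho}=\{\sum_k q_k^*q_k \text{ (finite sums)}: q_k\in\mathbb C[c,\bar c]_{r,\rho}\}$ (with $\Sigma_{-1,\rho}=\{0\}$), and $$Q_{r,\rho}=\Big\{s_0+s_1\Big(1-\sum_{\max_i|a_i|\le\rho}w_a c_a\bar c_a\Big):\ s_0\in\Sigma_{r,\rho},\ s_1\in\Sigma_{r-1,\rho}\Big\},\qquad Q_{\infty,\infty}=\bigcup_{r,\rho\in\mathbb N}Q_{r,\rho}.$$ For a square summable family $y=(y_{\mathbf s})$ of complex numbers indexed by the monomials $\mathbf s$ of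 $\mathbb C[c,\bar c]$, let $\ell_y$ be the linear functional on $\mathbb C[c,\bar c]$ that sends each monomial $\mathbf s$ to $y_{\mathbf s}$. Let $C^{\mathrm{out}}_{\infty,\infty}(A)\subset\mathbb C^N$ be the set of vectors $(y_{\mathbf a_1},\dots,y_{\mathbf a_N})$, where $\mathbf a_k$ stands for the monomial $\prod_{a\in\mathbf a_k}c_a$ and $y$ runs through the square summable families for which $\ell_y(p)$ is real and nonnegative for every $p\in Q_{\infty,\infty}$. Then, for either choice of the norm and every $A$, the closure of $C^{\mathrm{out}}_{\infty,\infty}(A)$ in $\mathbb C^N$ equals $C(A)$: $$\overline{C^{\mathrm{out}}_{\infty,\infty}(A)}=C(A).$$ -/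

import Mathlib

open MeasureTheory
open scoped ContDiff ComplexConjugate

noncomputable section

namespace SobolevMoment

/-- The frequency lattice `ℤⁿ`. -/
abbrev Freq (n : ℕ) : Type := Fin n → ℤ

/-- Multi-indices `α ∈ ℕⁿ` of partial derivatives. -/
abbrev MultiIndex (n : ℕ) : Type := Fin n → ℕ

/-- The Lebesgue measure on the unit torus `Tⁿ = (ℝ/ℤ)ⁿ`, of total mass one. -/
abbrev torusMeasure (n : ℕ) : Measure (UnitAddTorus (Fin n)) :=
  Measure.pi fun _ => AddCircle.haarAddCircle

/-- Complex-valued square integrable functions on the unit torus. -/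
abbrev L2 (n : ℕ) : Type := Lp ℂ 2 (torusMeasure n)

/-- `L²(Tⁿ)` carries the Borel σ-algebra of its norm topology. -/
instance instMeasurableSpaceL2 (n : ℕ) : MeasurableSpace (L2 n) := borel (L2 n)

instance instBorelSpaceL2 (n : ℕ) : BorelSpace (L2 n) := ⟨rfl⟩

/-! ### Sobolev spaces on the torus -/

/-- A function on the torus is smooth if its periodic lift to `ℝⁿ` is `C^∞`. -/
def IsSmooth {n : ℕ} (φ : UnitAddTorus (Fin n) → ℂ) : Prop :=
  ContDiff ℝ ∞ (fun v : Fin n → ℝ => φ (fun i => ((v i : ℝ) : UnitAddCircle)))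

/-- The partial derivative `∂φ/∂xᵢ` of a function on the torus. -/
def partialDeriv {n : ℕ} (i : Fin n) (φ : UnitAddTorus (Fin n) → ℂ) :
    UnitAddTorus (Fin n) → ℂ :=
  fun x => deriv (fun t : ℝ => φ (x + Pi.single i (t : UnitAddCircle))) 0

/-- The classical partial derivative `D^α φ`, differentiating `α i` times in direction `i`. -/
def iterPartialDeriv {n : ℕ} (α : MultiIndex n) (φ : UnitAddTorus (Fin n) → ℂ) :
    UnitAddTorus (Fin n) → ℂ :=
  (List.finRange n).foldr (fun i ψ => (partialDeriv i)^[α i] ψ) φ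

/-- `g ∈ L²(Tⁿ)` is the weak derivative `D^α f` of `f ∈ L²(Tⁿ)`. -/
def IsWeakDeriv {n : ℕ} (α : MultiIndex n) (f g : L2 n) : Prop :=
  ∀ φ : UnitAddTorus (Fin n) → ℂ, IsSmooth φ →
    ∫ x, f x * iterPartialDeriv α φ x ∂(torusMeasure n) =
      (-1) ^ (∑ i, α i) * ∫ x, g x * φ x ∂(torusMeasure n)

/-- `H^m(Tⁿ)`: all weak derivatives up to order `m` exist in `L²(Tⁿ)`. -/
def sobolevSpace (n m : ℕ) : Set (L2 n) :=
  {f | ∀ α : MultiIndex n, ∑ i, α i ≤ m → ∃ g : L2 n, IsWeakDeriv α f g}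

open Classical in
/-- The weak derivative `D^α f` (zero if there is none in `L²(Tⁿ)`). -/
def weakDeriv {n : ℕ} (α : MultiIndex n) (f : L2 n) : L2 n :=
  if h : ∃ g : L2 n, IsWeakDeriv α f g then h.choose else 0

/-- The multi-indices `α` with `|α| ≤ m`. -/
def multiIndices (n m : ℕ) : Finset (MultiIndex n) :=
  (Fintype.piFinset fun _ : Fin n => Finset.range (m + 1)).filter fun α => ∑ i, α i ≤ m

/-- The Fourier coefficient `c_a = ∫ f(x) e^{-2πi⟨a,x⟩} dx`. -/
def coeff {n : ℕ} (f : L2 n) (a : Freq n) : ℂ := UnitAddTorus.mFourierCoeff f a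

/-- The two usual Hilbert norms on `H^m(Tⁿ)`: the one made of the `L²` norms of the derivatives
and the one given by the weights `(1 + |a|²)^m` on the Fourier coefficients. -/
inductive SobolevNorm
  | derivative
  | fourier

/-- The weight `w_a` through which the squared norm reads `∑_a w_a |c_a|²`. -/
def SobolevNorm.weight (κ : SobolevNorm) {n : ℕ} (m : ℕ) (a : Freq n) : ℝ :=
  match κ with
  | .derivative => ∑ α ∈ multiIndices n m, ∏ i, (2 * Real.pi * (a i : ℝ)) ^ (2 * α i)
  | .fourier => (1 + ∑ i, (a i : ℝ) ^ 2) ^ m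

/-- The squared norm of `f ∈ H^m(Tⁿ)` (the series in the second case converges for such `f`). -/
def SobolevNorm.normSq (κ : SobolevNorm) {n : ℕ} (m : ℕ) (f : L2 n) : ℝ :=
  match κ with
  | .derivative => ∑ α ∈ multiIndices n m, ‖weakDeriv α f‖ ^ 2
  | .fourier => ∑' a : Freq n, (1 + ∑ i, (a i : ℝ) ^ 2) ^ m * ‖coeff f a‖ ^ 2

/-- The closed unit ball `B` of `H^m(Tⁿ)`. -/
def ball (κ : SobolevNorm) (n m : ℕ) : Set (L2 n) :=
  {f | f ∈ sobolevSpace n m ∧ κ.normSq m f ≤ 1}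

/-! ### The Sobolev moment cone -/

/-- The monomial `m_𝐚(f) = ∏_{a ∈ 𝐚} c_a`, for a finite family `𝐚` of frequencies with
repetitions. -/
def monomial {n : ℕ} (s : Multiset (Freq n)) (f : L2 n) : ℂ := (s.map (coeff f)).prod

/-- The Sobolev moment cone `C(A)`: the vectors `(∫_B m_𝐚 dμ)_{𝐚 ∈ A}` for nonnegative Radon
measures (locally finite, inner regular for compact sets) `μ` supported on `B`. -/
def momentCone (κ : SobolevNorm) {n N : ℕ} (m : ℕ) (A : Fin N → Multiset (Freq n)) :
    Set (Fin N → ℂ) :=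
  {y | ∃ μ : Measure (L2 n), IsLocallyFiniteMeasure μ ∧ μ.InnerRegular ∧
    μ (ball κ n m)ᶜ = 0 ∧ ∀ k, y k = ∫ f in ball κ n m, monomial (A k) f ∂μ}

/-! ### The outer approximation -/

/-- The variables: `Sum.inl a` stands for `c_a` and `Sum.inr a` for its conjugate. -/
abbrev Var (n : ℕ) : Type := Freq n ⊕ Freq n

/-- Complex polynomials in the `c_a` and their conjugates. -/
abbrev Poly (n : ℕ) : Type := MvPolynomial (Var n) ℂ

/-- The frequency of a variable. -/
def Var.freq {n : ℕ} (v : Var n) : Freq n := Sum.elim id id v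

/-- The conjugate polynomial `q*`: coefficients are conjugated and `c_a` is exchanged with its
conjugate. -/
def conjPoly {n : ℕ} (q : Poly n) : Poly n :=
  MvPolynomial.rename Sum.swap (MvPolynomial.map (starRingEnd ℂ) q)

/-- Polynomials of algebraic degree at most `r` and harmonic degree at most `ρ`. -/
def boundedPolys (n r ρ : ℕ) : Set (Poly n) :=
  {q | q.totalDegree ≤ r ∧ ∀ v ∈ q.vars, ∀ i, |v.freq i| ≤ (ρ : ℤ)}

/-- Hermitian sums of squares `∑ₖ qₖ* qₖ` with `qₖ` of degrees at most `r` and `ρ`. -/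
def sos (n r ρ : ℕ) : Set (Poly n) :=
  {p | ∃ (K : ℕ) (q : Fin K → Poly n),
    (∀ k, q k ∈ boundedPolys n r ρ) ∧ p = ∑ k, conjPoly (q k) * q k}

/-- The polynomial `1 - ∑_{a : max |aᵢ| ≤ ρ} w_a |c_a|²`. -/
def ellipsoidPoly (κ : SobolevNorm) (n m ρ : ℕ) : Poly n :=
  1 - ∑ a ∈ Fintype.piFinset (fun _ : Fin n => Finset.Icc (-(ρ : ℤ)) (ρ : ℤ)),
    MvPolynomial.C ((κ.weight m a : ℝ) : ℂ) *
      (MvPolynomial.X (Sum.inl a) * MvPolynomial.X (Sum.inr a))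

/-- The truncated quadratic module `Q_{r,ρ}`; for `r = 0` the multiplier `s₁` of degree
`r - 1 < 0` is zero. -/
def quadraticModule (κ : SobolevNorm) (n m r ρ : ℕ) : Set (Poly n) :=
  {p | ∃ s₀ ∈ sos n r ρ, ∃ s₁ : Poly n, (s₁ = 0 ∨ ∃ k, k + 1 = r ∧ s₁ ∈ sos n k ρ) ∧
    p = s₀ + s₁ * ellipsoidPoly κ n m ρ}

/-- The quadratic module `Q_{∞,∞}`, the union of all `Q_{r,ρ}`. -/
def quadraticModuleTop (κ : SobolevNorm) (n m : ℕ) : Set (Poly n) :=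
  ⋃ (r : ℕ) (ρ : ℕ), quadraticModule κ n m r ρ

/-- The linear functional `ℓ_y` sending each monomial to the entry of `y` of the same index. -/
def riesz {n : ℕ} (y : (Var n →₀ ℕ) → ℂ) (p : Poly n) : ℂ :=
  ∑ s ∈ p.support, p.coeff s * y s

/-- The exponent of the monomial `∏_{a ∈ 𝐚} c_a`, which involves no conjugates. -/
def exponent {n : ℕ} (s : Multiset (Freq n)) : Var n →₀ ℕ := (s.map Sum.inl).toFinsupp

/-- The projection `Π_A` of `{y ∈ ℓ² : ℓ_y(p) is real and nonnegative for all p ∈ Q}`. -/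
def outerCone {n N : ℕ} (Q : Set (Poly n)) (A : Fin N → Multiset (Freq n)) :
    Set (Fin N → ℂ) :=
  {z | ∃ y : (Var n →₀ ℕ) → ℂ, Memℓp y 2 ∧
    (∀ p ∈ Q, 0 ≤ (riesz y p).re ∧ (riesz y p).im = 0) ∧ ∀ k, z k = y (exponent (A k))}

end SobolevMoment

end

/-! Both sides are identified with one explicit cone, `pointCone`: the nonnegative multiples of the
convex hull of the moment vectors of single points. Fourier series turn $B$ into the ellipsoid
$\sum_a w_a|c_a|^2\le 1$ for either norm (`mem_ball_iff`), which is compact in the product topology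
because $w_a\ge 1$.

Outer cone inside `pointCone`: an admissible $y$ is a positive functional $L$ on the polynomial
ring. If $L(1)=0$ then $L=0$ by Cauchy–Schwarz; otherwise $L$ can be scaled to a state. The
ellipsoid condition makes multiplication by every polynomial bounded, uniformly in $L$
(`exists_bound`), so the states form a compact convex set and Krein–Milman applies. An extreme state
is multiplicative (`map_mul_of_extreme`), hence is evaluation at a point of the ellipsoid. Thus the
moment vector of a state lies in the compact set `momentHull`.

`pointCone` is closed (`isClosed_pointCone`): it either has a compact base missing the origin or is
a linear subspace.

`pointCone` inside the closure of the outer cone: evaluation at $c$ is positive, but its values on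
monomials need not be square summable; those of $tc$ with $0\le t<1$ are, and $t\to 1$.

Moment cone equals `pointCone`: Dirac measures give one inclusion. For the other, the Rellich-type
lemma `totallyBounded_ball` makes the measures finite, and the mean of a function with values in a
closed convex set stays in that set. -/

noncomputable section

namespace SobolevMoment

open Filter Topology

/-! ### Calculus on the torus -/

/-- The projection `ℝⁿ → Tⁿ`. -/
def torusMk {n : ℕ} (v : Fin n → ℝ) : UnitAddTorus (Fin n) := fun i => (v i : UnitAddCircle)

theorem isOpenQuotientMap_torusMk (n : ℕ) : IsOpenQuotientMap (torusMk (n := n)) := by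
  have h : IsOpenQuotientMap ((↑) : ℝ → UnitAddCircle) :=
    QuotientAddGroup.isOpenQuotientMap_mk
  exact IsOpenQuotientMap.piMap fun _ : Fin n => h

theorem IsSmooth.continuous {n : ℕ} {φ : UnitAddTorus (Fin n) → ℂ} (h : IsSmooth φ) :
    Continuous φ :=
  (isOpenQuotientMap_torusMk n).isQuotientMap.continuous_iff.2 (ContDiff.continuous h)

theorem torusMk_add_smul {n : ℕ} (v : Fin n → ℝ) (i : Fin n) (t : ℝ) :
    torusMk v + Pi.single i (t : UnitAddCircle) = torusMk (v + t • Pi.single i 1) := by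
  ext j
  rcases eq_or_ne j i with rfl | hj
  · simp [torusMk]
  · simp [torusMk, hj]

theorem IsSmooth.hasDerivAt_zero {n : ℕ} {φ : UnitAddTorus (Fin n) → ℂ} (h : IsSmooth φ)
    (i : Fin n) (v : Fin n → ℝ) :
    HasDerivAt (fun t : ℝ => φ (torusMk v + Pi.single i (t : UnitAddCircle)))
      (fderiv ℝ (φ ∘ torusMk) v (Pi.single i 1)) 0 := by
  have hd : HasFDerivAt (φ ∘ torusMk) (fderiv ℝ (φ ∘ torusMk) v) (v + (0 : ℝ) • Pi.single i 1) := by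
    rw [zero_smul, add_zero]
    exact ((ContDiff.differentiable h (by simp)) v).hasFDerivAt
  have hl : HasDerivAt (fun t : ℝ => v + t • (Pi.single i 1 : Fin n → ℝ)) (Pi.single i 1) 0 := by
    simpa using ((hasDerivAt_id (0 : ℝ)).smul_const (Pi.single i 1 : Fin n → ℝ)).const_add v
  have := hd.comp_hasDerivAt (0 : ℝ) hl
  simp only [torusMk_add_smul]
  exact this

theorem IsSmooth.partialDeriv_torusMk {n : ℕ} {φ : UnitAddTorus (Fin n) → ℂ} (h : IsSmooth φ)
    (i : Fin n) (v : Fin n → ℝ) :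
    partialDeriv i φ (torusMk v) = fderiv ℝ (φ ∘ torusMk) v (Pi.single i 1) :=
  (h.hasDerivAt_zero i v).deriv

theorem IsSmooth.partialDeriv {n : ℕ} {φ : UnitAddTorus (Fin n) → ℂ} (h : IsSmooth φ)
    (i : Fin n) : IsSmooth (partialDeriv i φ) := by
  have : (fun v : Fin n → ℝ => SobolevMoment.partialDeriv i φ (torusMk v)) =
      fun v => fderiv ℝ (φ ∘ torusMk) v (Pi.single i 1) :=
    funext fun v => h.partialDeriv_torusMk i v
  change ContDiff ℝ ∞ (fun v : Fin n → ℝ => SobolevMoment.partialDeriv i φ (torusMk v))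
  rw [this]
  exact (ContDiff.fderiv_right (m := ∞) h (by simp)).clm_apply contDiff_const

/-- Moving the base point along the line turns the derivative at time $0$ into the derivative at
every time, as differentiation under the integral sign requires. -/
theorem IsSmooth.hasDerivAt {n : ℕ} {φ : UnitAddTorus (Fin n) → ℂ} (h : IsSmooth φ)
    (i : Fin n) (x : UnitAddTorus (Fin n)) (t : ℝ) :
    HasDerivAt (fun s : ℝ => φ (x + Pi.single i (s : UnitAddCircle)))
      (SobolevMoment.partialDeriv i φ (x + Pi.single i (t : UnitAddCircle))) t := by
  obtain ⟨v, hv⟩ := (isOpenQuotientMap_torusMk n).surjective (x + Pi.single i (t : UnitAddCircle))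
  have h0 := h.hasDerivAt_zero i v
  rw [← h.partialDeriv_torusMk i v, hv, ← sub_self t] at h0
  have h1 := HasDerivAt.comp_sub_const t t h0
  refine h1.congr_of_eventuallyEq (Eventually.of_forall fun s => ?_)
  change _ = φ (x + Pi.single i (t : UnitAddCircle) + Pi.single i ((s - t : ℝ) : UnitAddCircle))
  rw [add_assoc, ← Pi.single_add, ← AddCircle.coe_add, add_sub_cancel]

theorem IsSmooth.mul {n : ℕ} {φ ψ : UnitAddTorus (Fin n) → ℂ} (hφ : IsSmooth φ)
    (hψ : IsSmooth ψ) : IsSmooth (fun x => φ x * ψ x) :=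
  ContDiff.mul hφ hψ

theorem partialDeriv_mul {n : ℕ} {φ ψ : UnitAddTorus (Fin n) → ℂ} (hφ : IsSmooth φ)
    (hψ : IsSmooth ψ) (i : Fin n) (x : UnitAddTorus (Fin n)) :
    partialDeriv i (fun x => φ x * ψ x) x =
      partialDeriv i φ x * ψ x + φ x * partialDeriv i ψ x := by
  have := ((hφ.hasDerivAt i x 0).mul (hψ.hasDerivAt i x 0)).deriv
  simpa [Pi.mul_def] using! this

theorem continuous_integrable {n : ℕ} {φ : UnitAddTorus (Fin n) → ℂ} (h : Continuous φ) :
    Integrable φ (torusMeasure n) :=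
  h.integrable_of_hasCompactSupport (HasCompactSupport.of_compactSpace φ)

/-- The integral of a partial derivative over the torus vanishes. -/
theorem integral_partialDeriv {n : ℕ} {φ : UnitAddTorus (Fin n) → ℂ} (h : IsSmooth φ)
    (i : Fin n) : ∫ x, partialDeriv i φ x ∂(torusMeasure n) = 0 := by
  have hc := (h.partialDeriv i).continuous
  obtain ⟨C, hC⟩ := (isCompact_range hc).isBounded.exists_norm_le
  let e (t : ℝ) : UnitAddTorus (Fin n) := Pi.single i (t : UnitAddCircle)
  have hcont (t : ℝ) : Continuous fun x : UnitAddTorus (Fin n) => x + e t := continuous_add_const _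
  have h1 (t : ℝ) : Continuous fun x => φ (x + e t) := h.continuous.comp (hcont t)
  have h2 (t : ℝ) : Continuous fun x => SobolevMoment.partialDeriv i φ (x + e t) :=
    hc.comp (hcont t)
  have hd := (hasDerivAt_integral_of_dominated_loc_of_deriv_le (μ := torusMeasure n)
    (F := fun (t : ℝ) x => φ (x + e t))
    (F' := fun (t : ℝ) x => SobolevMoment.partialDeriv i φ (x + e t))
    (x₀ := (0 : ℝ)) (s := Set.univ) (bound := fun _ => C) univ_mem
    (Eventually.of_forall fun t => (h1 t).aestronglyMeasurable)
    (continuous_integrable (h1 0)) (h2 0).aestronglyMeasurable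
    (Eventually.of_forall fun x t _ => hC _ (Set.mem_range_self _)) (integrable_const C)
    (Eventually.of_forall fun x t _ => h.hasDerivAt i x t)).2
  -- Translation invariance makes this integral constant in $t$; its derivative at $0$ is the
  -- integral of the partial derivative.
  have hconst : (fun t : ℝ => ∫ x, φ (x + e t) ∂(torusMeasure n)) =
      fun _ => ∫ x, φ x ∂(torusMeasure n) :=
    funext fun t => integral_add_right_eq_self φ _
  rw [hconst] at hd
  have he : e 0 = 0 := by simp [e]
  have := hd.unique (hasDerivAt_const _ _)
  simpa only [he, add_zero] using this

theorem isSmooth_mFourier {n : ℕ} (a : Freq n) : IsSmooth (UnitAddTorus.mFourier a) := by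
  change ContDiff ℝ ∞ fun v : Fin n → ℝ => ∏ i, fourier (a i) ((v i : ℝ) : UnitAddCircle)
  simp only [fourier_coe_apply]
  refine contDiff_prod fun i _ => ?_
  have : ContDiff ℝ ∞ fun v : Fin n → ℝ => ((v i : ℝ) : ℂ) :=
    Complex.ofRealCLM.contDiff.comp (contDiff_apply ℝ ℝ i)
  exact ((contDiff_const.mul this).div_const _).cexp

theorem partialDeriv_mFourier {n : ℕ} (a : Freq n) (i : Fin n) (x : UnitAddTorus (Fin n)) :
    partialDeriv i (UnitAddTorus.mFourier a) x =
      2 * Real.pi * Complex.I * a i * UnitAddTorus.mFourier a x := by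
  have hsplit (t : ℝ) : UnitAddTorus.mFourier a (x + Pi.single i (t : UnitAddCircle)) =
      UnitAddTorus.mFourier a x * fourier (a i) (t : UnitAddCircle) := by
    simp only [UnitAddTorus.mFourier, ContinuousMap.coe_mk]
    rw [← Finset.mul_prod_erase _ _ (Finset.mem_univ i),
      ← Finset.mul_prod_erase _ (fun j => fourier (a j) (x j)) (Finset.mem_univ i)]
    have : ∏ j ∈ Finset.univ.erase i, fourier (a j)
        ((x + Pi.single i (t : UnitAddCircle) : UnitAddTorus (Fin n)) j) =
        ∏ j ∈ Finset.univ.erase i, fourier (a j) (x j) :=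
      Finset.prod_congr rfl fun j hj => by
        simp [Finset.ne_of_mem_erase hj]
    rw [this, Pi.add_apply, Pi.single_eq_same, fourier_apply, fourier_apply, fourier_apply,
      smul_add, AddCircle.toCircle_add, Circle.coe_mul]
    ring
  have hd := ((hasDerivAt_fourier 1 (a i) 0).const_mul (UnitAddTorus.mFourier a x))
  have : partialDeriv i (UnitAddTorus.mFourier a) x = _ :=
    ((hd.congr_of_eventuallyEq (Eventually.of_forall hsplit)).deriv)
  rw [this]
  simp
  ring

/-- Integration by parts against a Fourier mode. -/
theorem mFourierCoeff_partialDeriv {n : ℕ} {φ : UnitAddTorus (Fin n) → ℂ} (h : IsSmooth φ)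
    (i : Fin n) (a : Freq n) :
    UnitAddTorus.mFourierCoeff (partialDeriv i φ) a =
      2 * Real.pi * Complex.I * a i * UnitAddTorus.mFourierCoeff φ a := by
  have he := isSmooth_mFourier (-a)
  have h0 := integral_partialDeriv (he.mul h) i
  simp only [partialDeriv_mul he h, partialDeriv_mFourier] at h0
  have hc := (h.partialDeriv i).continuous
  have hc' := h.continuous
  rw [integral_add (continuous_integrable (by fun_prop))
    (continuous_integrable (by fun_prop))] at h0
  simp only [mul_assoc, integral_const_mul] at h0
  change ∫ x, UnitAddTorus.mFourier (-a) x * partialDeriv i φ x ∂(torusMeasure n) =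
    _ * ∫ x, UnitAddTorus.mFourier (-a) x * φ x ∂(torusMeasure n)
  rw [eq_neg_of_add_eq_zero_right h0]
  push_cast [Pi.neg_apply]
  ring

/-- The symbol `∏ᵢ (2πi aᵢ)^αᵢ` of `D^α`. -/
def symbol {n : ℕ} (α : MultiIndex n) (a : Freq n) : ℂ :=
  ∏ i, (2 * Real.pi * Complex.I * a i) ^ α i

theorem isSmooth_iterate {n : ℕ} {φ : UnitAddTorus (Fin n) → ℂ} (h : IsSmooth φ) (i : Fin n)
    (k : ℕ) : IsSmooth ((partialDeriv i)^[k] φ) := by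
  induction k with
  | zero => exact h
  | succ k ih => rw [Function.iterate_succ_apply']; exact ih.partialDeriv i

theorem mFourierCoeff_iterate {n : ℕ} {φ : UnitAddTorus (Fin n) → ℂ} (h : IsSmooth φ) (i : Fin n)
    (k : ℕ) (a : Freq n) :
    UnitAddTorus.mFourierCoeff ((partialDeriv i)^[k] φ) a =
      (2 * Real.pi * Complex.I * a i) ^ k * UnitAddTorus.mFourierCoeff φ a := by
  induction k with
  | zero => simp
  | succ k ih =>
    rw [Function.iterate_succ_apply', mFourierCoeff_partialDeriv (isSmooth_iterate h i k), ih,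
      pow_succ']
    ring

theorem isSmooth_foldr {n : ℕ} {φ : UnitAddTorus (Fin n) → ℂ} (h : IsSmooth φ)
    (α : MultiIndex n) (l : List (Fin n)) :
    IsSmooth (l.foldr (fun i ψ => (partialDeriv i)^[α i] ψ) φ) := by
  induction l with
  | nil => exact h
  | cons i l ih => exact isSmooth_iterate ih i _

theorem IsSmooth.iterPartialDeriv {n : ℕ} {φ : UnitAddTorus (Fin n) → ℂ} (h : IsSmooth φ)
    (α : MultiIndex n) : IsSmooth (iterPartialDeriv α φ) := isSmooth_foldr h α _

theorem mFourierCoeff_iterPartialDeriv {n : ℕ} {φ : UnitAddTorus (Fin n) → ℂ} (h : IsSmooth φ)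
    (α : MultiIndex n) (a : Freq n) :
    UnitAddTorus.mFourierCoeff (iterPartialDeriv α φ) a =
      symbol α a * UnitAddTorus.mFourierCoeff φ a := by
  rw [symbol, Fin.prod_univ_def, SobolevMoment.iterPartialDeriv]
  induction List.finRange n with
  | nil => simp
  | cons i l ih =>
    rw [List.foldr_cons, mFourierCoeff_iterate (isSmooth_foldr h α l), ih, List.map_cons,
      List.prod_cons]
    ring

theorem iterate_partialDeriv_const_mul {n : ℕ} {φ : UnitAddTorus (Fin n) → ℂ} {i : Fin n} {c : ℂ}
    (h : partialDeriv i φ = fun x => c * φ x) (k : ℕ) (d : ℂ) :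
    (partialDeriv i)^[k] (fun x => d * φ x) = fun x => c ^ k * d * φ x := by
  induction k with
  | zero => simp
  | succ k ih =>
    rw [Function.iterate_succ_apply', ih]
    funext x
    change deriv (fun t : ℝ => c ^ k * d * φ (x + Pi.single i (t : UnitAddCircle))) 0 = _
    rw [deriv_const_mul_field]
    change c ^ k * d * partialDeriv i φ x = _
    rw [h]
    ring

theorem iterPartialDeriv_mFourier {n : ℕ} (α : MultiIndex n) (a : Freq n) :
    iterPartialDeriv α (UnitAddTorus.mFourier a) =
      fun x => symbol α a * UnitAddTorus.mFourier a x := by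
  rw [symbol, Fin.prod_univ_def, SobolevMoment.iterPartialDeriv]
  induction List.finRange n with
  | nil => simp
  | cons i l ih =>
    rw [List.foldr_cons, ih, iterate_partialDeriv_const_mul
      (funext fun x => partialDeriv_mFourier a i x), List.map_cons, List.prod_cons]

theorem symbol_neg {n : ℕ} (α : MultiIndex n) (a : Freq n) :
    symbol α (-a) = (-1) ^ (∑ i, α i) * symbol α a := by
  rw [symbol, symbol, ← Finset.prod_pow_eq_pow_sum, ← Finset.prod_mul_distrib]
  refine Finset.prod_congr rfl fun i _ => ?_
  rw [← mul_pow]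
  push_cast [Pi.neg_apply]
  ring

/-! ### Weak derivatives through Fourier coefficients -/

/-- The Fourier basis of `L²(Tⁿ)`. -/
def fourierBasis (n : ℕ) : HilbertBasis (Freq n) ℂ (L2 n) := UnitAddTorus.mFourierBasis

theorem fourierBasis_repr {n : ℕ} (f : L2 n) (a : Freq n) :
    (fourierBasis n).repr f a = coeff f a := UnitAddTorus.mFourierBasis_repr f a

theorem hasSum_norm_coeff_sq {n : ℕ} (f : L2 n) :
    HasSum (fun a => ‖coeff f a‖ ^ 2) (‖f‖ ^ 2) := by
  have h := lp.hasSum_norm (p := 2) (by norm_num) ((fourierBasis n).repr f)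
  simpa [fourierBasis_repr] using h

theorem exists_coeff_eq {n : ℕ} {c : Freq n → ℂ} (hc : Summable fun a => ‖c a‖ ^ 2) :
    ∃ f : L2 n, ∀ a, coeff f a = c a := by
  have hm : Memℓp c 2 := memℓp_gen (by simpa using hc)
  refine ⟨(fourierBasis n).repr.symm ⟨c, hm⟩, fun a => ?_⟩
  rw [← fourierBasis_repr]
  simp

theorem continuous_coeff {n : ℕ} (a : Freq n) : Continuous fun f : L2 n => coeff f a := by
  simp only [← fourierBasis_repr, HilbertBasis.repr_apply_apply]
  fun_prop

/-- Parseval for the pair $\bar\varphi$, $f$; the conjugation moves the coefficient of $\varphi$ to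
the frequency $-a$. -/
theorem hasSum_integral_mul {n : ℕ} (f : L2 n) {φ : UnitAddTorus (Fin n) → ℂ}
    (h : Continuous φ) :
    HasSum (fun a => coeff f a * UnitAddTorus.mFourierCoeff φ (-a))
      (∫ x, f x * φ x ∂(torusMeasure n)) := by
  set g : C(UnitAddTorus (Fin n), ℂ) := ⟨fun x => conj (φ x), by fun_prop⟩ with hg
  let G : L2 n := ContinuousMap.toLp (E := ℂ) 2 (torusMeasure n) ℂ g
  have hG : ∀ᵐ x ∂(torusMeasure n), G x = conj (φ x) :=
    ContinuousMap.coeFn_toLp (torusMeasure n) g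
  have hs : HasSum (fun a => conj (coeff G a) * coeff f a)
      (∫ x, conj (G x) * f x ∂(torusMeasure n)) :=
    UnitAddTorus.hasSum_prod_mFourierCoeff G f
  have h1 : ∫ x, conj (G x) * f x ∂(torusMeasure n) = ∫ x, f x * φ x ∂(torusMeasure n) := by
    refine integral_congr_ae ?_
    filter_upwards [hG] with x hx
    rw [hx, Complex.conj_conj, mul_comm]
  rw [h1] at hs
  refine hs.congr_fun fun a => ?_
  rw [mul_comm]
  congr 1
  change ∫ x, UnitAddTorus.mFourier (- -a) x * φ x ∂(torusMeasure n) =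
    conj (∫ x, UnitAddTorus.mFourier (-a) x * G x ∂(torusMeasure n))
  rw [← integral_conj]
  refine integral_congr_ae ?_
  filter_upwards [hG] with x hx
  rw [hx, map_mul, Complex.conj_conj, UnitAddTorus.mFourier_neg (n := -a)]

theorem coeff_eq_integral {n : ℕ} (f : L2 n) (a : Freq n) :
    coeff f a = ∫ x, f x * UnitAddTorus.mFourier (-a) x ∂(torusMeasure n) := by
  simp_rw [mul_comm (f _)]
  rfl

/-- Testing against the mode of frequency $-a$ isolates the coefficient at $a$. Conversely Parseval
expands both integrals, and the sign $(-1)^{|\alpha|}$ is absorbed by `symbol_neg`. -/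
theorem isWeakDeriv_iff {n : ℕ} (α : MultiIndex n) (f g : L2 n) :
    IsWeakDeriv α f g ↔ ∀ a, coeff g a = symbol α a * coeff f a := by
  have hsq : ((-1 : ℂ) ^ (∑ i, α i)) * (-1) ^ (∑ i, α i) = 1 := by
    rw [← mul_pow]; norm_num
  constructor
  · intro h a
    have h1 := h _ (isSmooth_mFourier (-a))
    simp only [iterPartialDeriv_mFourier, symbol_neg] at h1
    rw [← coeff_eq_integral] at h1
    simp only [mul_left_comm (f _), integral_const_mul] at h1
    rw [← coeff_eq_integral, mul_assoc] at h1
    calc coeff g a = ((-1 : ℂ) ^ (∑ i, α i)) * ((-1) ^ (∑ i, α i) * coeff g a) := by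
          rw [← mul_assoc, hsq, one_mul]
      _ = _ := by rw [← h1, ← mul_assoc, hsq, one_mul]
  · intro h φ hφ
    have h1 := hasSum_integral_mul f (hφ.iterPartialDeriv α).continuous
    have h2 := (hasSum_integral_mul g hφ.continuous).mul_left ((-1 : ℂ) ^ (∑ i, α i))
    refine h1.unique (h2.congr_fun fun a => ?_)
    rw [mFourierCoeff_iterPartialDeriv hφ, symbol_neg, h a]
    ring

theorem exists_isWeakDeriv_iff {n : ℕ} (α : MultiIndex n) (f : L2 n) :
    (∃ g, IsWeakDeriv α f g) ↔ Summable fun a => ‖symbol α a‖ ^ 2 * ‖coeff f a‖ ^ 2 := by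
  simp only [isWeakDeriv_iff, ← mul_pow, ← norm_mul]
  constructor
  · rintro ⟨g, hg⟩
    simpa [hg] using (hasSum_norm_coeff_sq g).summable
  · exact exists_coeff_eq

theorem hasSum_norm_weakDeriv_sq {n : ℕ} {α : MultiIndex n} {f : L2 n}
    (h : ∃ g, IsWeakDeriv α f g) :
    HasSum (fun a => ‖symbol α a‖ ^ 2 * ‖coeff f a‖ ^ 2) (‖weakDeriv α f‖ ^ 2) := by
  rw [weakDeriv, dif_pos h]
  have h1 := hasSum_norm_coeff_sq h.choose
  simp only [(isWeakDeriv_iff α f _).1 h.choose_spec, norm_mul, mul_pow] at h1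
  exact h1

/-! ### The weights -/

theorem mem_multiIndices {n m : ℕ} {α : MultiIndex n} :
    α ∈ multiIndices n m ↔ ∑ i, α i ≤ m := by
  simp only [multiIndices, Finset.mem_filter, Fintype.mem_piFinset, Finset.mem_range,
    and_iff_right_iff_imp, Nat.lt_succ_iff]
  intro h i
  exact (Finset.single_le_sum (fun _ _ => Nat.zero_le _) (Finset.mem_univ i)).trans h

theorem norm_symbol_sq {n : ℕ} (α : MultiIndex n) (a : Freq n) :
    ‖symbol α a‖ ^ 2 = ∏ i, (2 * Real.pi * (a i : ℝ)) ^ (2 * α i) := by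
  rw [symbol, norm_prod, ← Finset.prod_pow]
  refine Finset.prod_congr rfl fun i _ => ?_
  rw [norm_pow, ← pow_mul, mul_comm (α i), pow_mul, pow_mul]
  congr 1
  simp [mul_pow, abs_of_pos Real.pi_pos]

theorem weight_derivative {n : ℕ} (m : ℕ) (a : Freq n) :
    SobolevNorm.derivative.weight m a = ∑ α ∈ multiIndices n m, ‖symbol α a‖ ^ 2 := by
  simp only [norm_symbol_sq, SobolevNorm.weight]

theorem norm_symbol_sq_le_weight_derivative {n m : ℕ} {α : MultiIndex n} (hα : ∑ i, α i ≤ m)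
    (a : Freq n) : ‖symbol α a‖ ^ 2 ≤ SobolevNorm.derivative.weight m a := by
  rw [weight_derivative]
  exact Finset.single_le_sum (f := fun α => ‖symbol α a‖ ^ 2) (fun _ _ => by positivity)
    (mem_multiIndices.2 hα)

theorem one_le_weight (κ : SobolevNorm) {n : ℕ} (m : ℕ) (a : Freq n) : 1 ≤ κ.weight m a := by
  cases κ with
  | derivative =>
    simpa [symbol] using norm_symbol_sq_le_weight_derivative (m := m) (α := 0) (by simp) a
  | fourier =>
    exact one_le_pow₀ (le_add_of_nonneg_right (Finset.sum_nonneg fun i _ => sq_nonneg _))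

theorem sq_pow_le_weight_derivative {n m : ℕ} (i : Fin n) (a : Freq n) :
    ((a i : ℝ) ^ 2) ^ m ≤ SobolevNorm.derivative.weight m a := by
  refine le_trans ?_ (norm_symbol_sq_le_weight_derivative (α := Pi.single i m) (by simp) a)
  rw [norm_symbol_sq, ← pow_mul, Finset.prod_eq_single i (fun j _ hj => by simp [hj]) (by simp),
    Pi.single_eq_same, mul_pow, pow_mul (2 * Real.pi)]
  refine le_mul_of_one_le_left (by rw [pow_mul]; positivity) (one_le_pow₀ ?_)
  nlinarith [Real.pi_gt_three]

theorem sq_le_weight (κ : SobolevNorm) {n m : ℕ} (hm : 0 < m) (i : Fin n) (a : Freq n) :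
    (a i : ℝ) ^ 2 ≤ κ.weight m a := by
  have hs : (a i : ℝ) ^ 2 ≤ ∑ i, (a i : ℝ) ^ 2 :=
    Finset.single_le_sum (f := fun i => (a i : ℝ) ^ 2) (fun _ _ => sq_nonneg _) (Finset.mem_univ i)
  cases κ with
  | derivative =>
    refine le_trans ?_ (sq_pow_le_weight_derivative i a)
    rcases eq_or_ne (a i) 0 with h | h
    · simp [h, hm.ne']
    · refine le_self_pow₀ ?_ hm.ne'
      have h1 : (1 : ℤ) ≤ a i ^ 2 := by
        rw [← sq_abs]
        exact one_le_pow₀ (Int.one_le_abs h)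
      exact_mod_cast h1
  | fourier =>
    have h0 : (0 : ℝ) ≤ ∑ i, (a i : ℝ) ^ 2 := Finset.sum_nonneg fun i _ => sq_nonneg _
    exact (hs.trans (by linarith)).trans (le_self_pow₀ (by linarith) hm.ne')

theorem weight_fourier_le {n m : ℕ} (a : Freq n) :
    SobolevNorm.fourier.weight m a ≤ (n + 1) ^ (m + 1) * SobolevNorm.derivative.weight m a := by
  have hw := one_le_weight .derivative m a
  have h0 : ∀ i, 0 ≤ (a i : ℝ) ^ 2 := fun i => sq_nonneg _
  cases m with
  | zero =>
    simp only [SobolevNorm.weight, pow_zero] at hw ⊢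
    have : (1 : ℝ) ≤ (n + 1) ^ (0 + 1) := one_le_pow₀ (by simp)
    nlinarith
  | succ m =>
    -- Power mean inequality for the $n+1$ numbers $1,a_1^2,\dots,a_n^2$; each of their powers is at
    -- most the derivative weight.
    have h := pow_sum_le_card_mul_sum_pow (s := Finset.univ)
      (f := fun o : Option (Fin n) => o.elim (1 : ℝ) fun i => (a i : ℝ) ^ 2)
      (by rintro (_ | i) _ <;> simp [sq_nonneg]) m
    simp only [Fintype.sum_option, Option.elim_none, Option.elim_some, one_pow, Finset.card_univ,
      Fintype.card_option, Fintype.card_fin] at h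
    refine h.trans ?_
    have hs := Finset.sum_le_sum fun i (_ : i ∈ Finset.univ) =>
      sq_pow_le_weight_derivative (m := m + 1) i a
    rw [Finset.sum_const, Finset.card_univ, Fintype.card_fin, nsmul_eq_mul] at hs
    push_cast
    rw [pow_succ _ (m + 1), mul_assoc]
    refine mul_le_mul (pow_le_pow_right₀ (by simp) m.le_succ) ?_
      (add_nonneg zero_le_one (Finset.sum_nonneg fun i _ => by positivity)) (by positivity)
    linarith

theorem norm_symbol_sq_le_weight_fourier {n m : ℕ} {α : MultiIndex n} (hα : ∑ i, α i ≤ m)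
    (a : Freq n) :
    ‖symbol α a‖ ^ 2 ≤ ((2 * Real.pi) ^ 2) ^ m * SobolevNorm.fourier.weight m a := by
  have h0 : (0 : ℝ) ≤ ∑ i, (a i : ℝ) ^ 2 := Finset.sum_nonneg fun i _ => sq_nonneg _
  have h1 : (1 : ℝ) ≤ (2 * Real.pi) ^ 2 := one_le_pow₀ (by nlinarith [Real.pi_gt_three])
  rw [norm_symbol_sq, SobolevNorm.weight, ← mul_pow]
  refine le_trans ?_ (pow_le_pow_right₀ (by nlinarith) hα)
  rw [← Finset.prod_pow_eq_pow_sum]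
  refine Finset.prod_le_prod (fun i _ => by rw [pow_mul]; positivity) fun i _ => ?_
  rw [pow_mul, mul_pow]
  gcongr
  have := Finset.single_le_sum (f := fun i => (a i : ℝ) ^ 2) (fun _ _ => sq_nonneg _)
    (Finset.mem_univ i)
  linarith

theorem exists_norm_symbol_sq_le (κ : SobolevNorm) {n m : ℕ} {α : MultiIndex n}
    (hα : ∑ i, α i ≤ m) : ∃ C : ℝ, ∀ a, ‖symbol α a‖ ^ 2 ≤ C * κ.weight m a := by
  cases κ with
  | derivative => exact ⟨1, fun a => by simpa using norm_symbol_sq_le_weight_derivative hα a⟩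
  | fourier => exact ⟨_, fun a => norm_symbol_sq_le_weight_fourier hα a⟩

/-! ### The ball in terms of Fourier coefficients -/

theorem hasSum_weight_derivative {n m : ℕ} {f : L2 n} (hf : f ∈ sobolevSpace n m) :
    HasSum (fun a => SobolevNorm.derivative.weight m a * ‖coeff f a‖ ^ 2)
      (SobolevNorm.derivative.normSq m f) := by
  simp only [weight_derivative, Finset.sum_mul, SobolevNorm.normSq]
  exact hasSum_sum fun α hα => hasSum_norm_weakDeriv_sq (hf α (mem_multiIndices.1 hα))

theorem hasSum_weight (κ : SobolevNorm) {n m : ℕ} {f : L2 n} (hf : f ∈ sobolevSpace n m) :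
    HasSum (fun a => κ.weight m a * ‖coeff f a‖ ^ 2) (κ.normSq m f) := by
  cases κ with
  | derivative => exact hasSum_weight_derivative hf
  | fourier =>
    refine Summable.hasSum (Summable.of_nonneg_of_le (fun a => ?_) (fun a => ?_)
      ((hasSum_weight_derivative hf).summable.mul_left ((n + 1 : ℝ) ^ (m + 1))))
    · have := one_le_weight .fourier m a
      positivity
    · rw [← mul_assoc]
      exact mul_le_mul_of_nonneg_right (weight_fourier_le a) (by positivity)

theorem mem_sobolevSpace_of_summable (κ : SobolevNorm) {n m : ℕ} {f : L2 n}
    (hf : Summable fun a => κ.weight m a * ‖coeff f a‖ ^ 2) : f ∈ sobolevSpace n m := by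
  intro α hα
  obtain ⟨C, hC⟩ := exists_norm_symbol_sq_le κ hα
  rw [exists_isWeakDeriv_iff]
  refine Summable.of_nonneg_of_le (fun a => by positivity) (fun a => ?_) (hf.mul_left C)
  rw [← mul_assoc]
  exact mul_le_mul_of_nonneg_right (hC a) (by positivity)

/-- The families of coefficients with `∑_a w_a |c_a|² ≤ 1`. -/
def ellipsoid (κ : SobolevNorm) (n m : ℕ) : Set (Freq n → ℂ) :=
  {c | ∀ F : Finset (Freq n), ∑ a ∈ F, κ.weight m a * ‖c a‖ ^ 2 ≤ 1}

theorem summable_of_mem_ellipsoid {κ : SobolevNorm} {n m : ℕ} {c : Freq n → ℂ}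
    (hc : c ∈ ellipsoid κ n m) : Summable fun a => κ.weight m a * ‖c a‖ ^ 2 :=
  summable_of_sum_le (fun a => mul_nonneg (zero_le_one.trans (one_le_weight κ m a))
    (by positivity)) hc

/-- Membership in $H^m$ guarantees that the series for the norm converges, so bounding it is the
same as bounding all finite partial sums. From here on the norm enters only through its weights. -/
theorem mem_ball_iff {κ : SobolevNorm} {n m : ℕ} {f : L2 n} :
    f ∈ ball κ n m ↔ coeff f ∈ ellipsoid κ n m := by
  have h0 (a : Freq n) : 0 ≤ κ.weight m a * ‖coeff f a‖ ^ 2 :=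
    mul_nonneg (zero_le_one.trans (one_le_weight κ m a)) (by positivity)
  constructor
  · rintro ⟨hf, h1⟩ F
    exact (sum_le_hasSum F (fun a _ => h0 a) (hasSum_weight κ hf)).trans h1
  · intro hc
    have hf := mem_sobolevSpace_of_summable κ (summable_of_mem_ellipsoid hc)
    exact ⟨hf, hasSum_le_of_sum_le (hasSum_weight κ hf) hc⟩

theorem norm_sq_le_of_mem_ellipsoid {κ : SobolevNorm} {n m : ℕ} {c : Freq n → ℂ}
    (hc : c ∈ ellipsoid κ n m) (F : Finset (Freq n)) : ∑ a ∈ F, ‖c a‖ ^ 2 ≤ 1 :=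
  (Finset.sum_le_sum fun a _ =>
    le_mul_of_one_le_left (by positivity) (one_le_weight κ m a)).trans (hc F)

theorem norm_le_one_of_mem_ellipsoid {κ : SobolevNorm} {n m : ℕ} {c : Freq n → ℂ}
    (hc : c ∈ ellipsoid κ n m) (a : Freq n) : ‖c a‖ ≤ 1 := by
  have := norm_sq_le_of_mem_ellipsoid hc {a}
  rw [Finset.sum_singleton] at this
  exact (sq_le_one_iff₀ (norm_nonneg _)).1 this

theorem exists_mem_ball_coeff_eq {κ : SobolevNorm} {n m : ℕ} {c : Freq n → ℂ}
    (hc : c ∈ ellipsoid κ n m) : ∃ f ∈ ball κ n m, coeff f = c := by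
  obtain ⟨f, hf⟩ := exists_coeff_eq
    (summable_of_sum_le (fun a => by positivity) (norm_sq_le_of_mem_ellipsoid hc))
  have hf' : coeff f = c := funext hf
  exact ⟨f, mem_ball_iff.2 (hf' ▸ hc), hf'⟩

/-- Tychonoff: each coordinate lies in the unit disc, and each finite-sum condition is closed for
pointwise convergence. -/
theorem isCompact_ellipsoid (κ : SobolevNorm) (n m : ℕ) : IsCompact (ellipsoid κ n m) := by
  refine (isCompact_univ_pi fun _ : Freq n => isCompact_closedBall (0 : ℂ) 1).of_isClosed_subset
    ?_ fun c hc a _ => by simpa using norm_le_one_of_mem_ellipsoid hc a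
  simp only [ellipsoid, Set.ofPred_forall]
  exact isClosed_iInter fun F => isClosed_le (by fun_prop) continuous_const

/-! ### Compactness of the ball -/

theorem finite_weight_le (κ : SobolevNorm) (n : ℕ) {m : ℕ} (hm : 0 < m) (R : ℝ) :
    {a : Freq n | κ.weight m a ≤ R}.Finite := by
  obtain ⟨k, hk⟩ := exists_nat_ge R
  refine (Set.Finite.pi' fun _ : Fin n => Set.finite_Icc (-(k : ℤ)) k).subset fun a ha i => ?_
  have h1 : (a i : ℝ) ^ 2 ≤ k := ((sq_le_weight κ hm i a).trans ha).trans hk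
  have h2 : (a i) ^ 2 ≤ (k : ℤ) := by exact_mod_cast h1
  rw [Set.mem_Icc, ← abs_le]
  rw [← sq_abs] at h2
  rcases eq_or_ne (a i) 0 with h | h
  · simp [h]
  · nlinarith [Int.one_le_abs h]

theorem norm_sub_sum_coeff_sq {n : ℕ} (f : L2 n) (F : Finset (Freq n)) :
    HasSum (fun a => if a ∈ F then 0 else ‖coeff f a‖ ^ 2)
      (‖f - ∑ a ∈ F, coeff f a • fourierBasis n a‖ ^ 2) := by
  classical
  refine (hasSum_norm_coeff_sq _).congr_fun fun a => ?_
  have : coeff (f - ∑ b ∈ F, coeff f b • fourierBasis n b) a =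
      coeff f a - if a ∈ F then coeff f a else 0 := by
    simp only [← fourierBasis_repr, HilbertBasis.repr_apply_apply, inner_sub_right, inner_sum,
      inner_smul_right, orthonormal_iff_ite.1 (fourierBasis n).orthonormal]
    simp
  rw [this]
  split_ifs <;> simp

/-- Frequencies with $w_a>(2/\varepsilon)^2$ contribute at most $(\varepsilon/2)^2$ to the squared
$L^2$ norm. Only finitely many others remain since $m\ge 1$, and truncation to them maps the
ellipsoid onto a compact set. -/
theorem totallyBounded_ball (κ : SobolevNorm) (n : ℕ) {m : ℕ} (hm : 0 < m) :
    TotallyBounded (ball κ n m) := by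
  rw [Metric.totallyBounded_iff]
  intro ε hε
  set F := (finite_weight_le κ n hm ((2 / ε) ^ 2)).toFinset with hF
  let P : (Freq n → ℂ) → L2 n := fun c => ∑ a ∈ F, c a • fourierBasis n a
  have hP : IsCompact (P '' ellipsoid κ n m) :=
    (isCompact_ellipsoid κ n m).image (by fun_prop)
  obtain ⟨t, ht, hsub⟩ := Metric.totallyBounded_iff.1 hP.totallyBounded (ε / 2) (half_pos hε)
  refine ⟨t, ht, fun f hf => ?_⟩
  have hc := mem_ball_iff.1 hf
  obtain ⟨g, hg, hfg⟩ := Set.mem_iUnion₂.1 (hsub ⟨_, hc, rfl⟩)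
  refine Set.mem_iUnion₂.2 ⟨g, hg, ?_⟩
  have h1 : ‖f - P (coeff f)‖ ^ 2 ≤ (ε / 2) ^ 2 := by
    refine hasSum_le_of_sum_le (norm_sub_sum_coeff_sq f F) fun G => ?_
    calc ∑ a ∈ G, (if a ∈ F then 0 else ‖coeff f a‖ ^ 2)
        ≤ ∑ a ∈ G, (ε / 2) ^ 2 * (κ.weight m a * ‖coeff f a‖ ^ 2) := by
          refine Finset.sum_le_sum fun a _ => ?_
          have hw := one_le_weight κ m a
          split_ifs with ha
          · positivity
          · rw [hF, Set.Finite.mem_toFinset, Set.mem_ofPred_eq, not_le] at ha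
            rw [← mul_assoc]
            refine le_mul_of_one_le_left (by positivity) ?_
            calc (1 : ℝ) = (ε / 2) ^ 2 * (2 / ε) ^ 2 := by field_simp
              _ ≤ _ := by gcongr
      _ ≤ (ε / 2) ^ 2 := by
          rw [← Finset.mul_sum]
          exact mul_le_of_le_one_right (by positivity) (hc G)
  have h2 := abs_le_of_sq_le_sq h1 (by positivity)
  rw [abs_of_nonneg (norm_nonneg _), ← dist_eq_norm] at h2
  have h3 : dist (P (coeff f)) g < ε / 2 := hfg
  rw [Metric.mem_ball]
  linarith [dist_triangle f (P (coeff f)) g]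

theorem measure_ball_lt_top (κ : SobolevNorm) (n : ℕ) {m : ℕ} (hm : 0 < m) (μ : Measure (L2 n))
    [IsLocallyFiniteMeasure μ] : μ (ball κ n m) < ⊤ :=
  (measure_mono subset_closure).trans_lt
    ((totallyBounded_ball κ n hm).closure.isCompact_of_isClosed isClosed_closure).measure_lt_top

open scoped ComplexOrder

/-! ### Hermitian squares -/

section HermitianSquares

variable {n : ℕ}

theorem conjPoly_add (p q : Poly n) : conjPoly (p + q) = conjPoly p + conjPoly q := by
  simp [conjPoly]

theorem conjPoly_sub (p q : Poly n) : conjPoly (p - q) = conjPoly p - conjPoly q := by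
  simp [conjPoly]

theorem conjPoly_neg (p : Poly n) : conjPoly (-p) = -conjPoly p := by
  simp [conjPoly]

theorem conjPoly_mul (p q : Poly n) : conjPoly (p * q) = conjPoly p * conjPoly q := by
  simp [conjPoly]

theorem conjPoly_one : conjPoly (1 : Poly n) = 1 := by
  simp [conjPoly]

theorem conjPoly_C (c : ℂ) : conjPoly (MvPolynomial.C c : Poly n) = MvPolynomial.C (conj c) := by
  simp [conjPoly]

theorem conjPoly_X (v : Var n) : conjPoly (MvPolynomial.X v) = MvPolynomial.X v.swap := by
  simp [conjPoly]

theorem conjPoly_conjPoly (p : Poly n) : conjPoly (conjPoly p) = p := by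
  induction p using MvPolynomial.induction_on with
  | C c => simp [conjPoly_C]
  | add p q hp hq => rw [conjPoly_add, conjPoly_add, hp, hq]
  | mul_X p v hp => rw [conjPoly_mul, conjPoly_mul, hp, conjPoly_X, conjPoly_X, Sum.swap_swap]

/-- The hermitian square `q* q`. -/
def hermSq (q : Poly n) : Poly n := conjPoly q * q

theorem hermSq_mul (p q : Poly n) : hermSq (p * q) = hermSq p * hermSq q := by
  simp only [hermSq, conjPoly_mul]; ring

theorem hermSq_one : hermSq (1 : Poly n) = 1 := by simp [hermSq, conjPoly_one]

theorem hermSq_C (c : ℂ) : hermSq (MvPolynomial.C c : Poly n) = MvPolynomial.C (conj c * c) := by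
  simp [hermSq, conjPoly_C]

theorem conjPoly_hermSq (q : Poly n) : conjPoly (hermSq q) = hermSq q := by
  rw [hermSq, conjPoly_mul, conjPoly_conjPoly, mul_comm]

theorem hermSq_X (a : Freq n) : hermSq (MvPolynomial.X (Sum.inl a) : Poly n) =
    MvPolynomial.X (Sum.inl a) * MvPolynomial.X (Sum.inr a) := by
  rw [hermSq, conjPoly_X, mul_comm]; rfl

/-- The polynomial `1 - ∑_{a ∈ F} w_a |c_a|²`. -/
def ellipsoidPolyOn (κ : SobolevNorm) (m : ℕ) (F : Finset (Freq n)) : Poly n :=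
  1 - ∑ a ∈ F, MvPolynomial.C ((κ.weight m a : ℝ) : ℂ) * hermSq (MvPolynomial.X (Sum.inl a))

theorem ellipsoidPolyOn_empty (κ : SobolevNorm) (m : ℕ) :
    ellipsoidPolyOn κ m (∅ : Finset (Freq n)) = 1 := by
  simp [ellipsoidPolyOn]

theorem ellipsoidPoly_eq (κ : SobolevNorm) (n m ρ : ℕ) : ellipsoidPoly κ n m ρ =
    ellipsoidPolyOn κ m (Fintype.piFinset fun _ : Fin n => Finset.Icc (-(ρ : ℤ)) (ρ : ℤ)) := by
  simp only [ellipsoidPoly, ellipsoidPolyOn, hermSq_X]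

theorem ellipsoidPolyOn_eq_add {κ : SobolevNorm} {m : ℕ} {F G : Finset (Freq n)} (h : F ⊆ G) :
    ellipsoidPolyOn κ m F = ellipsoidPolyOn κ m G +
      ∑ a ∈ G \ F, MvPolynomial.C ((κ.weight m a : ℝ) : ℂ) *
        hermSq (MvPolynomial.X (Sum.inl a)) := by
  simp only [ellipsoidPolyOn, ← Finset.sum_sdiff h]
  ring

theorem weight_nonneg (κ : SobolevNorm) (m : ℕ) (a : Freq n) :
    (0 : ℂ) ≤ ((κ.weight m a : ℝ) : ℂ) := by
  exact_mod_cast zero_le_one.trans (one_le_weight κ m a)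

theorem map_C_mul (L : Poly n →ₗ[ℂ] ℂ) (c : ℂ) (p : Poly n) :
    L (MvPolynomial.C c * p) = c * L p := by
  rw [MvPolynomial.C_mul', map_smul, smul_eq_mul]

end HermitianSquares

/-! ### Positive functionals -/

/-- A linear functional that is nonnegative on the quadratic module of the ellipsoid. -/
def IsPositive (κ : SobolevNorm) {n : ℕ} (m : ℕ) (L : Poly n →ₗ[ℂ] ℂ) : Prop :=
  ∀ (q : Poly n) (F : Finset (Freq n)), 0 ≤ L (hermSq q * ellipsoidPolyOn κ m F)

namespace IsPositive

variable {κ : SobolevNorm} {n m : ℕ} {L : Poly n →ₗ[ℂ] ℂ}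

theorem hermSq_nonneg (hL : IsPositive κ m L) (q : Poly n) : 0 ≤ L (hermSq q) := by
  simpa [ellipsoidPolyOn_empty] using hL q ∅

/-- Since $L$ is real on the hermitian squares of $1$, $q$, $1+q$ and $1+iq$, both $L(q+q^*)$ and
$iL(q-q^*)$ are real. -/
theorem map_conjPoly (hL : IsPositive κ m L) (q : Poly n) : L (conjPoly q) = conj (L q) := by
  have h1 := (Complex.le_def.1 (hL.hermSq_nonneg 1)).2
  have h2 := (Complex.le_def.1 (hL.hermSq_nonneg q)).2
  have h3 := (Complex.le_def.1 (hL.hermSq_nonneg (1 + q))).2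
  have h4 := (Complex.le_def.1 (hL.hermSq_nonneg (1 + MvPolynomial.C Complex.I * q))).2
  have e3 : hermSq (1 + q) = hermSq 1 + hermSq q + (q + conjPoly q) := by
    simp only [hermSq, conjPoly_add, conjPoly_one]; ring
  have e4 : hermSq (1 + MvPolynomial.C Complex.I * q) = hermSq 1 + hermSq q +
      (MvPolynomial.C Complex.I * q - MvPolynomial.C Complex.I * conjPoly q) := by
    have : (MvPolynomial.C Complex.I * MvPolynomial.C Complex.I : Poly n) = -1 := by
      rw [← map_mul, Complex.I_mul_I, map_neg, map_one]
    simp only [hermSq, conjPoly_add, conjPoly_one, conjPoly_mul, conjPoly_C, Complex.conj_I,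
      map_neg]
    linear_combination (-(conjPoly q * q)) * this
  rw [e3, map_add, map_add, map_add] at h3
  rw [e4, map_add, map_add, map_sub, map_C_mul, map_C_mul] at h4
  simp only [Complex.add_im, Complex.sub_im, Complex.mul_im, Complex.I_re, Complex.I_im,
    Complex.zero_im, zero_mul, one_mul, zero_add] at h1 h2 h3 h4
  apply Complex.ext
  · rw [Complex.conj_re]; linarith
  · rw [Complex.conj_im]; linarith

theorem map_one_nonneg (hL : IsPositive κ m L) : 0 ≤ L 1 := by
  simpa [hermSq_one] using hL.hermSq_nonneg 1

/-- Cauchy–Schwarz before optimizing, from the hermitian square of $b-rL(b)$. The free parameter $r$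
also serves the degenerate case $L(1)=0$. -/
theorem hermSq_sub_nonneg (hL : IsPositive κ m L) (b : Poly n) (r : ℝ) :
    0 ≤ (L (hermSq b)).re - 2 * r * ‖L b‖ ^ 2 + r ^ 2 * ‖L b‖ ^ 2 * (L 1).re := by
  have h := (Complex.le_def.1 (hL.hermSq_nonneg (b - MvPolynomial.C (r * L b)))).1
  have e : hermSq (b - MvPolynomial.C (r * L b)) = hermSq b - MvPolynomial.C (r * L b) * conjPoly b
      - MvPolynomial.C (r * conj (L b)) * b +
      MvPolynomial.C ((r ^ 2 : ℂ) * (conj (L b) * L b)) * 1 := by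
    rw [hermSq, conjPoly_sub, conjPoly_C, hermSq]
    simp only [map_mul, map_pow, Complex.conj_ofReal]
    ring
  rw [e, map_add, map_sub, map_sub, map_C_mul, map_C_mul, map_C_mul, hL.map_conjPoly] at h
  have e2 : L (hermSq b) - ↑r * L b * conj (L b) - ↑r * conj (L b) * L b +
      ↑r ^ 2 * (conj (L b) * L b) * L 1 =
      L (hermSq b) - ((2 * r * ‖L b‖ ^ 2 : ℝ) : ℂ) + ((r ^ 2 * ‖L b‖ ^ 2 : ℝ) : ℂ) * L 1 := by
    push_cast
    rw [← Complex.conj_mul']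
    ring
  rw [e2] at h
  simpa [-Complex.ofReal_mul, -Complex.ofReal_pow] using h

theorem norm_sq_le (hL : IsPositive κ m L) (h1 : L 1 = 1) (b : Poly n) :
    ‖L b‖ ^ 2 ≤ (L (hermSq b)).re := by
  have := hL.hermSq_sub_nonneg b 1
  rw [h1, Complex.one_re] at this
  linarith

theorem eq_zero (hL : IsPositive κ m L) (h1 : L 1 = 0) : L = 0 := by
  refine LinearMap.ext fun b => ?_
  by_contra hb
  have hpos : 0 < ‖L b‖ ^ 2 := pow_pos (norm_pos_iff.2 hb) 2
  -- With this $r$ the inequality reads $0\le L(b^*b)-(L(b^*b)+1)=-1$.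
  have := hL.hermSq_sub_nonneg b (((L (hermSq b)).re + 1) / (2 * ‖L b‖ ^ 2))
  rw [h1, Complex.zero_re, mul_zero, add_zero] at this
  have hne : ‖L b‖ ≠ 0 := norm_ne_zero_iff.2 hb
  have e : 2 * (((L (hermSq b)).re + 1) / (2 * ‖L b‖ ^ 2)) * ‖L b‖ ^ 2 =
      (L (hermSq b)).re + 1 := by field_simp
  linarith

/-- Positivity for the one-frequency ellipsoid $1-w_a|c_a|^2$, together with $w_a\ge 1$. -/
theorem mul_X_le (hL : IsPositive κ m L) (h : Poly n) (a : Freq n) :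
    L (hermSq (h * MvPolynomial.X (Sum.inl a))) ≤ L (hermSq h) := by
  have h1 := hL h {a}
  have h2 := mul_le_mul_of_nonneg_right
    (show (1 : ℂ) ≤ ((κ.weight m a : ℝ) : ℂ) by exact_mod_cast one_le_weight κ m a)
    (hL.hermSq_nonneg (h * MvPolynomial.X (Sum.inl a)))
  rw [ellipsoidPolyOn, Finset.sum_singleton, mul_sub, mul_one, mul_left_comm, map_sub, map_C_mul,
    ← hermSq_mul, sub_nonneg] at h1
  rw [one_mul] at h2
  exact h2.trans h1

/-- Multiplication by a polynomial is bounded, uniformly over the positive functionals. -/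
theorem exists_bound (κ : SobolevNorm) {n : ℕ} (m : ℕ) (q : Poly n) :
    ∃ N : ℝ, 0 < N ∧ ∀ L : Poly n →ₗ[ℂ] ℂ, IsPositive κ m L → ∀ h : Poly n,
      L (hermSq (h * q)) ≤ N * L (hermSq h) := by
  induction q using MvPolynomial.induction_on with
  | C c =>
    refine ⟨‖c‖ ^ 2 + 1, by positivity, fun L hL h => ?_⟩
    rw [hermSq_mul, hermSq_C, mul_comm, map_C_mul, Complex.conj_mul']
    refine mul_le_mul_of_nonneg_right ?_ (hL.hermSq_nonneg h)
    exact_mod_cast (le_add_of_nonneg_right zero_le_one : ‖c‖ ^ 2 ≤ ‖c‖ ^ 2 + 1)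
  | add p q hp hq =>
    obtain ⟨N, hN, h1⟩ := hp
    obtain ⟨M, hM, h2⟩ := hq
    refine ⟨2 * N + 2 * M, by positivity, fun L hL h => ?_⟩
    -- Parallelogram law: the square of the difference is nonnegative and can be dropped.
    have h3 := hL.hermSq_nonneg (h * (p - q))
    have e : hermSq (h * (p - q)) = MvPolynomial.C 2 * hermSq (h * p) +
        MvPolynomial.C 2 * hermSq (h * q) - hermSq (h * (p + q)) := by
      have : (MvPolynomial.C 2 : Poly n) = 2 := map_ofNat _ 2
      simp only [hermSq, conjPoly_mul, conjPoly_add, conjPoly_sub, this]; ring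
    rw [e, map_sub, map_add, map_C_mul, map_C_mul, sub_nonneg] at h3
    refine h3.trans ?_
    push_cast
    rw [add_mul, mul_assoc, mul_assoc]
    have h20 : (0 : ℂ) ≤ 2 := by exact_mod_cast (by norm_num : (0 : ℝ) ≤ 2)
    exact add_le_add (mul_le_mul_of_nonneg_left (h1 L hL h) h20)
      (mul_le_mul_of_nonneg_left (h2 L hL h) h20)
  | mul_X p v hp =>
    obtain ⟨N, hN, h1⟩ := hp
    refine ⟨N, hN, fun L hL h => ?_⟩
    -- The variables $c_a$ and $\bar c_a$ have the same hermitian square, so `mul_X_le` covers both.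
    have hv : hermSq (h * (p * MvPolynomial.X v)) =
        hermSq (h * p * MvPolynomial.X (Sum.inl v.freq)) := by
      rw [← mul_assoc, hermSq_mul, hermSq_mul _ (MvPolynomial.X (Sum.inl v.freq))]
      congr 1
      rcases v with a | a
      · rfl
      · simp only [hermSq, conjPoly_X, Var.freq, Sum.elim_inr, id, Sum.swap_inr, Sum.swap_inl]
        ring
    rw [hv]
    exact (hL.mul_X_le _ _).trans (h1 L hL h)

/-- A convex sequence whose first step goes up grows at least linearly, against the bound. -/
theorem le_of_convex_of_bounded {v : ℕ → ℝ} {C : ℝ} (hv : ∀ k, v k ≤ C)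
    (h : ∀ k, 0 ≤ v (k + 2) - 2 * v (k + 1) + v k) : v 1 ≤ v 0 := by
  by_contra! hlt
  have h1 : ∀ k, v 1 - v 0 ≤ v (k + 1) - v k := by
    intro k
    induction k with
    | zero => rfl
    | succ k ih => linarith [h k]
  have h2 : ∀ k : ℕ, k * (v 1 - v 0) ≤ v k - v 0 := by
    intro k
    induction k with
    | zero => simp
    | succ k ih => push_cast; linarith [h1 k]
  obtain ⟨k, hk⟩ := exists_nat_gt ((C - v 0) / (v 1 - v 0))
  rw [div_lt_iff₀ (sub_pos.2 hlt)] at hk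
  linarith [h2 k, hv k]

theorem mulLeft_hermSq (hL : IsPositive κ m L) (u : Poly n) :
    IsPositive κ m (L.comp (LinearMap.mulLeft ℂ (hermSq u))) := by
  intro q F
  rw [LinearMap.comp_apply, LinearMap.mulLeft_apply, ← mul_assoc, ← hermSq_mul]
  exact hL _ _

theorem le_of_ellipsoidPolyOn (hL : IsPositive κ m L) (q : Poly n) (F : Finset (Freq n)) :
    L (hermSq q * ellipsoidPolyOn κ m F) ≤ L (hermSq q) := by
  have h := ellipsoidPolyOn_eq_add (κ := κ) (m := m) (Finset.empty_subset F)
  rw [ellipsoidPolyOn_empty, Finset.sdiff_empty] at h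
  rw [← sub_nonneg, ← map_sub, ← mul_one_sub, h, add_sub_cancel_left, Finset.mul_sum, map_sum]
  refine Finset.sum_nonneg fun a _ => ?_
  rw [mul_left_comm, map_C_mul, ← hermSq_mul]
  exact mul_nonneg (weight_nonneg κ m a) (hL.hermSq_nonneg _)

/-- The factor $1-u^*u$ need not be a sum of squares, so the bound on multiplication by $u$ must be
transferred to the functional carrying the factor $e_F$. The numbers $v_k=L((qu^k)^*(qu^k)e_F)$ are
bounded above by $L(q^*q)$ and convex in $k$, their second difference being the value at
$qu^k(1-u^*u)$. Hence $v_1\le v_0$, which is the claim. -/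
theorem mulLeft_one_sub_hermSq (hL : IsPositive κ m L) {u : Poly n}
    (hu : ∀ h, L (hermSq (h * u)) ≤ L (hermSq h)) :
    IsPositive κ m (L.comp (LinearMap.mulLeft ℂ (1 - hermSq u))) := by
  intro q F
  set e := ellipsoidPolyOn κ m F with he
  let v : ℕ → ℂ := fun k => L (hermSq (q * u ^ k) * e)
  have hbound (k : ℕ) : L (hermSq (q * u ^ k)) ≤ L (hermSq q) := by
    induction k with
    | zero => simp
    | succ k ih => rw [pow_succ, ← mul_assoc]; exact (hu _).trans ih
  have hv (k : ℕ) : (v k).re ≤ (L (hermSq q)).re :=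
    (Complex.le_def.1 ((hL.le_of_ellipsoidPolyOn _ F).trans (hbound k))).1
  have hconv (k : ℕ) : 0 ≤ (v (k + 2)).re - 2 * (v (k + 1)).re + (v k).re := by
    have h := (Complex.le_def.1 (hL (q * u ^ k * (1 - hermSq u)) F)).1
    have e1 : hermSq (q * u ^ k * (1 - hermSq u)) * ellipsoidPolyOn κ m F =
        hermSq (q * u ^ (k + 2)) * e - MvPolynomial.C ((2 : ℝ) : ℂ) * (hermSq (q * u ^ (k + 1)) * e)
          + hermSq (q * u ^ k) * e := by
      have h2 : (MvPolynomial.C ((2 : ℝ) : ℂ) : Poly n) = 2 := by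
        rw [Complex.ofReal_ofNat]; exact map_ofNat _ 2
      have h3 : hermSq (1 - hermSq u) = (1 - hermSq u) ^ 2 := by
        rw [hermSq, conjPoly_sub, conjPoly_one, conjPoly_hermSq, sq]
      have h4 : hermSq (q * u ^ (k + 1)) = hermSq (q * u ^ k) * hermSq u := by
        rw [pow_succ, ← mul_assoc, hermSq_mul]
      have h5 : hermSq (q * u ^ (k + 2)) = hermSq (q * u ^ k) * hermSq u * hermSq u := by
        rw [pow_succ, ← mul_assoc, hermSq_mul, h4]
      rw [hermSq_mul, h3, h2, h4, h5, he]
      ring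
    rw [e1, map_add, map_sub, map_C_mul, Complex.add_re, Complex.sub_re,
      Complex.re_ofReal_mul] at h
    exact h
  have h01 := le_of_convex_of_bounded hv hconv
  have e2 : (1 - hermSq u) * (hermSq q * e) =
      hermSq (q * u ^ 0) * e - hermSq (q * u ^ 1) * e := by
    rw [pow_zero, pow_one, mul_one, hermSq_mul]; ring
  rw [LinearMap.comp_apply, LinearMap.mulLeft_apply, e2, map_sub, sub_nonneg, Complex.le_def]
  exact ⟨h01, ((Complex.le_def.1 (hL (q * u ^ 1) F)).2.symm.trans
    (Complex.le_def.1 (hL (q * u ^ 0) F)).2)⟩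

theorem smul (hL : IsPositive κ m L) {t : ℝ} (ht : 0 ≤ t) : IsPositive κ m ((t : ℂ) • L) :=
  fun q F => mul_nonneg (by exact_mod_cast ht) (hL q F)

theorem map_one_eq (hL : IsPositive κ m L) : L 1 = ((L 1).re : ℂ) :=
  Complex.eq_re_of_ofReal_le (r := 0) (by simpa using! hL.map_one_nonneg)

/-- A state that is extreme among the states is multiplicative. -/
theorem map_mul_of_extreme (hL : IsPositive κ m L) (h1 : L 1 = 1)
    (hext : ∀ (L₁ L₂ : Poly n →ₗ[ℂ] ℂ) (t : ℝ), IsPositive κ m L₁ → IsPositive κ m L₂ →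
      L₁ 1 = 1 → L₂ 1 = 1 → 0 < t → t < 1 →
      L = (t : ℂ) • L₁ + ((1 - t : ℝ) : ℂ) • L₂ → L₁ = L) (a b : Poly n) :
    L (a * b) = L a * L b := by
  -- Here $L$ splits into the positive functionals $L(u^*u\,\cdot)$ and $L((1-u^*u)\,\cdot)$ of
  -- masses $t$ and $1-t$. The factor $1/2$ keeps $1-t$ positive; for $t>0$ extremality identifies
  -- the normalized first part with $L$.
  have hsmall (u : Poly n) (hu : ∀ h, L (hermSq (h * u)) ≤ ((1 / 2 : ℝ) : ℂ) * L (hermSq h))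
      (b : Poly n) : L (hermSq u * b) = L (hermSq u) * L b := by
    have hL1 := hL.mulLeft_hermSq u
    have hL2 := hL.mulLeft_one_sub_hermSq (u := u) fun h => (hu h).trans
      (mul_le_of_le_one_left (hL.hermSq_nonneg h) (by norm_cast; norm_num))
    have e1 : (L.comp (LinearMap.mulLeft ℂ (hermSq u))) 1 = L (hermSq u) := by simp
    have e2 : (L.comp (LinearMap.mulLeft ℂ (1 - hermSq u))) 1 = 1 - L (hermSq u) := by simp [h1]
    set t := (L (hermSq u)).re with ht
    have htc : L (hermSq u) = (t : ℂ) := by rw [← e1, hL1.map_one_eq, e1]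
    have ht0 : 0 ≤ t := (Complex.le_def.1 (hL.hermSq_nonneg u)).1
    have ht2 : t ≤ 1 / 2 := by
      have := hu 1
      rw [one_mul, hermSq_one, h1, mul_one, htc] at this
      exact_mod_cast this
    rcases ht0.eq_or_lt with h0 | h0
    · rw [htc, ← h0, Complex.ofReal_zero, zero_mul]
      exact LinearMap.congr_fun (hL1.eq_zero (by rw [e1, htc, ← h0, Complex.ofReal_zero])) b
    · have hs : 0 < 1 - t := by linarith
      have hne : (t : ℂ) ≠ 0 := by exact_mod_cast h0.ne'
      have hne2 : ((1 - t : ℝ) : ℂ) ≠ 0 := by exact_mod_cast hs.ne'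
      have := hext _ _ t (hL1.smul (inv_nonneg.2 ht0)) (hL2.smul (inv_nonneg.2 hs.le))
        (by rw [LinearMap.smul_apply, e1, htc, smul_eq_mul, Complex.ofReal_inv,
          inv_mul_cancel₀ hne])
        (by rw [LinearMap.smul_apply, e2, htc, smul_eq_mul, Complex.ofReal_inv,
          Complex.ofReal_sub, Complex.ofReal_one, inv_mul_cancel₀]
            rwa [Complex.ofReal_sub, Complex.ofReal_one] at hne2) h0 (by linarith) ?_
      · have hb := LinearMap.congr_fun this b
        rw [LinearMap.smul_apply, LinearMap.comp_apply, LinearMap.mulLeft_apply, smul_eq_mul,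
          Complex.ofReal_inv] at hb
        rw [htc, ← hb, mul_inv_cancel_left₀ hne]
      · rw [smul_smul, smul_smul, Complex.ofReal_inv, Complex.ofReal_inv, mul_inv_cancel₀ hne,
          mul_inv_cancel₀ hne2, one_smul, one_smul]
        refine LinearMap.ext fun p => ?_
        simp [sub_mul]
  -- Scaling $q$ by $(2N)^{-1/2}$, with $N$ its multiplication bound, reduces to the previous case.
  have hsq (q b : Poly n) : L (hermSq q * b) = L (hermSq q) * L b := by
    obtain ⟨N, hN, hq⟩ := exists_bound κ m q
    have hc : (conj ((√(1 / (2 * N)) : ℝ) : ℂ)) * ((√(1 / (2 * N)) : ℝ) : ℂ) =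
        ((1 / (2 * N) : ℝ) : ℂ) := by
      rw [Complex.conj_ofReal, ← Complex.ofReal_mul, Real.mul_self_sqrt (by positivity)]
    have h := hsmall (MvPolynomial.C ((√(1 / (2 * N)) : ℝ) : ℂ) * q) (fun h => ?_) b
    · rw [hermSq_mul, hermSq_C, hc, mul_assoc, map_C_mul, map_C_mul, mul_assoc] at h
      exact mul_left_cancel₀ (by exact_mod_cast (by positivity : (1 / (2 * N) : ℝ) ≠ 0)) h
    · rw [mul_left_comm, hermSq_mul, hermSq_C, hc, map_C_mul]
      have h2N : (0 : ℂ) ≤ ((1 / (2 * N) : ℝ) : ℂ) := by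
        exact_mod_cast (by positivity : (0 : ℝ) ≤ 1 / (2 * N))
      refine (mul_le_mul_of_nonneg_left (hq L hL h) h2N).trans_eq ?_
      rw [← mul_assoc, ← Complex.ofReal_mul]
      congr 2
      field_simp
  -- Polarization: hermitian squares span the polynomial ring, so multiplicativity extends from
  -- them.
  have hpol (a : Poly n) : MvPolynomial.C 4 * a = hermSq (1 + a) +
      MvPolynomial.C (-Complex.I) * hermSq (1 + MvPolynomial.C Complex.I * a) +
      MvPolynomial.C (-1) * hermSq (1 + MvPolynomial.C (-1) * a) +
      MvPolynomial.C Complex.I * hermSq (1 + MvPolynomial.C (-Complex.I) * a) := by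
    have h4 : (MvPolynomial.C 4 : Poly n) = 4 := map_ofNat _ 4
    have hI : (MvPolynomial.C Complex.I * MvPolynomial.C Complex.I : Poly n) = -1 := by
      rw [← map_mul, Complex.I_mul_I, map_neg, map_one]
    simp only [hermSq, conjPoly_add, conjPoly_one, conjPoly_mul, conjPoly_C, Complex.conj_I,
      map_neg, map_one, conjPoly_neg, h4, neg_neg]
    linear_combination (2 * a - 2 * conjPoly a) * hI
  have h4 : (4 : ℂ) * L (a * b) = 4 * (L a * L b) := by
    rw [← map_C_mul L 4 (a * b), ← mul_assoc, ← mul_assoc, ← map_C_mul L 4 a, hpol]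
    simp only [add_mul, map_add, mul_assoc (MvPolynomial.C _), map_C_mul, hsq]
    ring
  exact mul_left_cancel₀ four_ne_zero h4

end IsPositive

/-! ### The functional of a family of numbers -/

section Riesz

variable {n : ℕ}

/-- The functional `ℓ_y` as a linear map. -/
def rieszMap (y : (Var n →₀ ℕ) → ℂ) : Poly n →ₗ[ℂ] ℂ :=
  (MvPolynomial.basisMonomials (Var n) ℂ).constr ℂ y

theorem rieszMap_apply (y : (Var n →₀ ℕ) → ℂ) (p : Poly n) : rieszMap y p = riesz y p := by
  rw [rieszMap, Module.Basis.constr_apply]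
  rfl

theorem rieszMap_monomial (y : (Var n →₀ ℕ) → ℂ) (s : Var n →₀ ℕ) :
    rieszMap y (MvPolynomial.monomial s 1) = y s := by
  have h := Module.Basis.constr_basis (MvPolynomial.basisMonomials (Var n) ℂ) ℂ y s
  rwa [MvPolynomial.coe_basisMonomials] at h

theorem rieszMap_one (y : (Var n →₀ ℕ) → ℂ) : rieszMap y 1 = y 0 := rieszMap_monomial y 0

theorem rieszMap_of_linearMap (L : Poly n →ₗ[ℂ] ℂ) :
    rieszMap (fun s => L (MvPolynomial.monomial s 1)) = L := by
  refine (MvPolynomial.basisMonomials (Var n) ℂ).ext fun s => ?_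
  rw [MvPolynomial.coe_basisMonomials]
  exact rieszMap_monomial _ s

theorem continuous_rieszMap (p : Poly n) :
    Continuous fun y : (Var n →₀ ℕ) → ℂ => rieszMap y p := by
  simp only [rieszMap_apply, riesz]
  fun_prop

theorem rieszMap_add (y z : (Var n →₀ ℕ) → ℂ) : rieszMap (y + z) = rieszMap y + rieszMap z :=
  map_add ((MvPolynomial.basisMonomials (Var n) ℂ).constr ℂ) y z

theorem rieszMap_smul (t : ℂ) (y : (Var n →₀ ℕ) → ℂ) : rieszMap (t • y) = t • rieszMap y :=
  map_smul ((MvPolynomial.basisMonomials (Var n) ℂ).constr ℂ) t y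

theorem monomial_exponent (s : Multiset (Freq n)) :
    (MvPolynomial.monomial (exponent s) 1 : Poly n) =
      (s.map fun a => MvPolynomial.X (Sum.inl a)).prod := by
  induction s using Multiset.induction_on with
  | empty => simp [exponent]
  | cons a s ih =>
    have : exponent (a ::ₘ s) = Finsupp.single (Sum.inl a) 1 + exponent s := by
      rw [exponent, exponent, Multiset.map_cons, ← Multiset.singleton_add, map_add,
        Multiset.toFinsupp_singleton]
    rw [this, Multiset.map_cons, Multiset.prod_cons, ← ih, MvPolynomial.X,
      MvPolynomial.monomial_mul, one_mul]

/-! ### Positivity on the quadratic module -/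

/-- The box of frequencies with `max |aᵢ| ≤ ρ`. -/
def box (n ρ : ℕ) : Finset (Freq n) :=
  Fintype.piFinset fun _ : Fin n => Finset.Icc (-(ρ : ℤ)) (ρ : ℤ)

theorem mem_box {ρ : ℕ} {a : Freq n} : a ∈ box n ρ ↔ ∀ i, |a i| ≤ (ρ : ℤ) := by
  simp [box, abs_le]

theorem exists_subset_box (F : Finset (Freq n)) : ∃ ρ, F ⊆ box n ρ := by
  refine ⟨F.sup fun a => Finset.univ.sup fun i => (a i).natAbs, fun a ha => mem_box.2 fun i => ?_⟩
  rw [Int.abs_eq_natAbs, Nat.cast_le]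
  exact (Finset.le_sup (f := fun i => (a i).natAbs) (Finset.mem_univ i)).trans
    (Finset.le_sup (f := fun a : Freq n => Finset.univ.sup fun i => (a i).natAbs) ha)

theorem exists_mem_boundedPolys (q : Poly n) (F : Finset (Freq n)) :
    ∃ ρ, F ⊆ box n ρ ∧ q ∈ boundedPolys n q.totalDegree ρ := by
  classical
  obtain ⟨ρ, hρ⟩ := exists_subset_box (F ∪ q.vars.image Var.freq)
  exact ⟨ρ, Finset.subset_union_left.trans hρ, le_rfl, fun v hv =>
    mem_box.1 (hρ (Finset.mem_union_right _ (Finset.mem_image_of_mem _ hv)))⟩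

theorem hermSq_mem_sos {q : Poly n} {r ρ : ℕ} (hq : q ∈ boundedPolys n r ρ) :
    hermSq q ∈ sos n r ρ :=
  ⟨1, fun _ => q, fun _ => hq, by simp [hermSq]⟩

theorem zero_mem_sos (n r ρ : ℕ) : (0 : Poly n) ∈ sos n r ρ :=
  ⟨0, Fin.elim0, fun k => k.elim0, by simp⟩

theorem hermSq_mem_quadraticModuleTop (κ : SobolevNorm) (m : ℕ) (q : Poly n) :
    hermSq q ∈ quadraticModuleTop κ n m := by
  obtain ⟨ρ, -, hq⟩ := exists_mem_boundedPolys q ∅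
  refine Set.mem_iUnion₂.2 ⟨q.totalDegree, ρ, hermSq q, hermSq_mem_sos hq, 0, Or.inl rfl, ?_⟩
  rw [zero_mul, add_zero]

theorem hermSq_mul_ellipsoidPoly_mem_quadraticModuleTop (κ : SobolevNorm) (m : ℕ) {q : Poly n}
    {r ρ : ℕ} (hq : q ∈ boundedPolys n r ρ) :
    hermSq q * ellipsoidPolyOn κ m (box n ρ) ∈ quadraticModuleTop κ n m := by
  refine Set.mem_iUnion₂.2 ⟨r + 1, ρ, 0, zero_mem_sos n _ ρ, hermSq q,
    Or.inr ⟨r, rfl, hermSq_mem_sos hq⟩, ?_⟩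
  rw [zero_add, ellipsoidPoly_eq, box]

/-- The quadratic module uses boxes, `IsPositive` all finite sets $F$. Enlarging $F$ to a box that
also holds the variables of $q$ changes $e_F$ by a nonnegative combination of hermitian squares. -/
theorem isPositive_rieszMap_iff (κ : SobolevNorm) (m : ℕ) (y : (Var n →₀ ℕ) → ℂ) :
    IsPositive κ m (rieszMap y) ↔
      ∀ p ∈ quadraticModuleTop κ n m, 0 ≤ (riesz y p).re ∧ (riesz y p).im = 0 := by
  have hle (p : Poly n) : (0 ≤ (riesz y p).re ∧ (riesz y p).im = 0) ↔ 0 ≤ rieszMap y p := by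
    rw [rieszMap_apply, Complex.le_def, Complex.zero_re, Complex.zero_im, eq_comm (a := (0 : ℝ))]
  simp only [hle]
  refine Iff.symm ⟨?_, ?_⟩
  · intro h q F
    obtain ⟨ρ, hF, hq⟩ := exists_mem_boundedPolys q F
    have h1 := h _ (hermSq_mul_ellipsoidPoly_mem_quadraticModuleTop κ m hq)
    rw [ellipsoidPolyOn_eq_add hF, mul_add, map_add, Finset.mul_sum, map_sum]
    refine add_nonneg h1 (Finset.sum_nonneg fun a _ => ?_)
    rw [mul_left_comm, map_C_mul, ← hermSq_mul]
    exact mul_nonneg (weight_nonneg κ m a) (h _ (hermSq_mem_quadraticModuleTop κ m _))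
  · intro h p hp
    obtain ⟨r, ρ, s₀, ⟨K, q, -, rfl⟩, s₁, hs₁, rfl⟩ := Set.mem_iUnion₂.1 hp
    rw [map_add, map_sum]
    refine add_nonneg (Finset.sum_nonneg fun k _ => h.hermSq_nonneg (q k)) ?_
    rcases hs₁ with rfl | ⟨k, -, K', q', -, rfl⟩
    · simp
    · rw [ellipsoidPoly_eq, Finset.sum_mul, map_sum]
      exact Finset.sum_nonneg fun k _ => h (q' k) _

end Riesz

/-! ### The state space -/

/-- The normalized positive functionals, given by their values on the monomials. -/
def states (κ : SobolevNorm) (n m : ℕ) : Set ((Var n →₀ ℕ) → ℂ) :=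
  {y | IsPositive κ m (rieszMap y) ∧ y 0 = 1}

section States

variable {κ : SobolevNorm} {n m : ℕ}

/-- Tychonoff: Cauchy–Schwarz and the uniform multiplication bound give $|y_{\mathbf s}|^2\le
L(\mathbf s^*\mathbf s)\le N_{\mathbf s}$, with $N_{\mathbf s}$ independent of the state. -/
theorem isCompact_states : IsCompact (states κ n m) := by
  choose N hN hb using IsPositive.exists_bound κ (n := n) m
  refine (isCompact_univ_pi fun s : Var n →₀ ℕ =>
    isCompact_closedBall (0 : ℂ) √(N (MvPolynomial.monomial s 1))).of_isClosed_subset ?_ ?_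
  · have : states κ n m = (⋂ (q : Poly n) (F : Finset (Freq n)),
        {y | 0 ≤ rieszMap y (hermSq q * ellipsoidPolyOn κ m F)}) ∩ {y | y 0 = 1} := by
      ext y; simp [states, IsPositive]
    rw [this]
    exact (isClosed_iInter fun q => isClosed_iInter fun F =>
      isClosed_le continuous_const (continuous_rieszMap _)).inter
        (isClosed_eq (continuous_apply _) continuous_const)
  · rintro y ⟨hy, h0⟩ s -
    have h1 : rieszMap y 1 = 1 := by rw [rieszMap_one, h0]
    have h2 := hy.norm_sq_le h1 (MvPolynomial.monomial s 1)
    have h3 := hb (MvPolynomial.monomial s 1) _ hy 1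
    rw [hermSq_one, h1, mul_one, one_mul, Complex.le_def, Complex.ofReal_re] at h3
    rw [rieszMap_monomial] at h2
    rw [mem_closedBall_zero_iff]
    exact Real.le_sqrt_of_sq_le (h2.trans h3.1)

theorem convex_states : Convex ℝ (states κ n m) := by
  rintro y ⟨hy, hy0⟩ z ⟨hz, hz0⟩ a b ha hb hab
  refine ⟨?_, ?_⟩
  · have e : rieszMap (a • y + b • z) = (a : ℂ) • rieszMap y + (b : ℂ) • rieszMap z := by
      rw [← rieszMap_smul, ← rieszMap_smul, ← rieszMap_add]
      rfl
    rw [e]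
    exact fun q F => add_nonneg (hy.smul ha q F) (hz.smul hb q F)
  · rw [Pi.add_apply, Pi.smul_apply, Pi.smul_apply, hy0, hz0, Complex.real_smul,
      Complex.real_smul, mul_one, mul_one, ← Complex.ofReal_add, hab, Complex.ofReal_one]

/-- The vector of moments `∏_{a ∈ A k} c_a` of a family of coefficients. -/
def momentMap {N : ℕ} (A : Fin N → Multiset (Freq n)) (c : Freq n → ℂ) : Fin N → ℂ :=
  fun k => ((A k).map c).prod

/-- The point is $c_a=L(c_a)$; by multiplicativity, positivity of $L$ on $e_F$ is exactly the
condition of the ellipsoid for $F$. -/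
theorem exists_of_mem_extremePoints {y : (Var n →₀ ℕ) → ℂ}
    (hy : y ∈ (states κ n m).extremePoints ℝ) :
    ∃ c ∈ ellipsoid κ n m, ∀ s : Multiset (Freq n), y (exponent s) = (s.map c).prod := by
  obtain ⟨⟨hpos, h0⟩, hext⟩ := hy
  have h1 : rieszMap y 1 = 1 := by rw [rieszMap_one, h0]
  have hmul := hpos.map_mul_of_extreme h1 fun L₁ L₂ t hL₁ hL₂ h₁ h₂ ht0 ht1 hL => by
    have hmem (L : Poly n →ₗ[ℂ] ℂ) (hL : IsPositive κ m L) (h : L 1 = 1) :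
        (fun s => L (MvPolynomial.monomial s 1)) ∈ states κ n m :=
      ⟨by rwa [rieszMap_of_linearMap], h⟩
    have := hext (hmem L₁ hL₁ h₁) (hmem L₂ hL₂ h₂)
      ⟨t, 1 - t, ht0, sub_pos.2 ht1, by ring, funext fun s => by
        rw [← rieszMap_monomial y s, hL]; rfl⟩
    rw [← rieszMap_of_linearMap L₁, this]
  refine ⟨fun a => rieszMap y (MvPolynomial.X (Sum.inl a)), fun F => ?_, fun s => ?_⟩
  · have hF := hpos 1 F
    rw [hermSq_one, one_mul, ellipsoidPolyOn, map_sub, map_sum, h1] at hF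
    have e (a : Freq n) : rieszMap y (MvPolynomial.C ((κ.weight m a : ℝ) : ℂ) *
        hermSq (MvPolynomial.X (Sum.inl a))) =
        ((κ.weight m a * ‖rieszMap y (MvPolynomial.X (Sum.inl a))‖ ^ 2 : ℝ) : ℂ) := by
      rw [map_C_mul, hermSq, hmul, hpos.map_conjPoly, Complex.conj_mul']
      push_cast
      rfl
    simp only [e] at hF
    rw [sub_nonneg] at hF
    exact_mod_cast hF
  · rw [← rieszMap_monomial y, monomial_exponent]
    induction s using Multiset.induction_on with
    | empty => simpa using h1
    | cons a s ih => rw [Multiset.map_cons, Multiset.prod_cons, hmul, ih, Multiset.map_cons,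
        Multiset.prod_cons]

/-- Krein–Milman, pushed forward by the continuous linear map that keeps the $N$ relevant entries.
-/
theorem mem_closure_of_mem_states {N : ℕ} (A : Fin N → Multiset (Freq n))
    {y : (Var n →₀ ℕ) → ℂ} (hy : y ∈ states κ n m) :
    (fun k => y (exponent (A k))) ∈
      closure (convexHull ℝ (momentMap A '' ellipsoid κ n m)) := by
  let T : ((Var n →₀ ℕ) → ℂ) →ₗ[ℝ] (Fin N → ℂ) :=
    LinearMap.funLeft ℝ ℂ fun k => exponent (A k)
  have hT : Continuous T := continuous_pi fun k => continuous_apply _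
  rw [← closure_convexHull_extremePoints isCompact_states convex_states] at hy
  have h := image_closure_subset_closure_image hT (Set.mem_image_of_mem T hy)
  rw [T.image_convexHull] at h
  refine closure_mono (convexHull_mono ?_) h
  rintro _ ⟨z, hz, rfl⟩
  obtain ⟨c, hc, hzc⟩ := exists_of_mem_extremePoints hz
  exact ⟨c, hc, funext fun k => (hzc (A k)).symm⟩

end States

/-! ### Convex hulls of compact sets -/

/-- In finite dimension, the convex hull of a compact set is compact. -/
theorem isCompact_convexHull {E : Type*} [NormedAddCommGroup E] [NormedSpace ℝ E]
    [FiniteDimensional ℝ E] {K : Set E} (hK : IsCompact K) : IsCompact (convexHull ℝ K) := by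
  -- The iterate $J^jK$ consists of convex combinations of $j+1$ points of $K$ and is compact by
  -- induction. Carathéodory bounds the number of points needed by the dimension plus one.
  let J : Set E → Set E := fun S =>
    (fun p : ℝ × E × E => (1 - p.1) • p.2.1 + p.1 • p.2.2) '' (Set.Icc 0 1 ×ˢ K ×ˢ S)
  have hJ (j : ℕ) : IsCompact (J^[j] K) := by
    induction j with
    | zero => exact hK
    | succ j ih =>
      rw [Function.iterate_succ_apply']
      exact (isCompact_Icc.prod (hK.prod ih)).image (by fun_prop)
  have hsub (j : ℕ) : J^[j] K ⊆ convexHull ℝ K := by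
    induction j with
    | zero => exact subset_convexHull ℝ K
    | succ j ih =>
      rw [Function.iterate_succ_apply']
      rintro _ ⟨⟨t, x, y⟩, ⟨ht, hx, hy⟩, rfl⟩
      exact convex_convexHull ℝ K (subset_convexHull ℝ K hx) (ih hy) (sub_nonneg.2 ht.2) ht.1
        (by ring)
  have hfin (j : ℕ) : ∀ t : Finset E, (t : Set E) ⊆ K → t.card = j + 1 →
      convexHull ℝ (t : Set E) ⊆ J^[j] K := by
    classical
    induction j with
    | zero =>
      intro t ht hc
      obtain ⟨x, rfl⟩ := Finset.card_eq_one.1 hc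
      simpa using ht
    | succ j ih =>
      intro t ht hc
      obtain ⟨x, s, hx, rfl, hs⟩ := Finset.card_eq_succ.1 hc
      rw [Finset.coe_insert, Set.insert_subset_iff] at ht
      have hne : (s : Set E).Nonempty := Finset.card_pos.1 (by omega)
      rw [Function.iterate_succ_apply', Finset.coe_insert, convexHull_insert hne,
        convexJoin_singleton_left]
      refine Set.iUnion₂_subset fun y hy => ?_
      rw [segment_eq_image]
      rintro _ ⟨θ, hθ, rfl⟩
      exact ⟨(θ, x, y), ⟨hθ, ht.1, ih s ht.2 hs hy⟩, rfl⟩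
  have : convexHull ℝ K = ⋃ j ∈ Finset.range (Module.finrank ℝ E + 1), J^[j] K := by
    refine Set.Subset.antisymm ?_ (Set.iUnion₂_subset fun j _ => hsub j)
    rw [convexHull_eq_union]
    refine Set.iUnion_subset fun t => Set.iUnion₂_subset fun ht hind => ?_
    rcases t.eq_empty_or_nonempty with rfl | hne
    · simp
    · have hcard : t.card ≤ Module.finrank ℝ E + 1 := by
        simpa using hind.card_le_finrank_succ.trans
          (Nat.succ_le_succ (Submodule.finrank_le _))
      have hpos := hne.card_pos
      exact (hfin (t.card - 1) t ht (by omega)).trans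
        (Set.subset_biUnion_of_mem (u := fun j => J^[j] K) (Finset.mem_range.2 (by omega)))
  rw [this]
  exact (Finset.range _).isCompact_biUnion fun j _ => hJ j

/-! ### The cone over the moment vectors of the points of the ellipsoid -/

section Cone

variable {κ : SobolevNorm} {n m N : ℕ} {A : Fin N → Multiset (Freq n)}

/-- The convex hull of the moment vectors of the points of the ellipsoid. -/
def momentHull (κ : SobolevNorm) {n N : ℕ} (m : ℕ) (A : Fin N → Multiset (Freq n)) :
    Set (Fin N → ℂ) :=
  convexHull ℝ (momentMap A '' ellipsoid κ n m)

/-- The cone over `momentHull`. -/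
def pointCone (κ : SobolevNorm) {n N : ℕ} (m : ℕ) (A : Fin N → Multiset (Freq n)) :
    Set (Fin N → ℂ) :=
  {z | ∃ t : ℝ, 0 ≤ t ∧ ∃ p ∈ momentHull κ m A, t • p = z}

theorem continuous_momentMap (A : Fin N → Multiset (Freq n)) : Continuous (momentMap A) :=
  continuous_pi fun _ => continuous_multiset_prod _ fun a _ => continuous_apply a

theorem isCompact_momentHull : IsCompact (momentHull κ m A) :=
  isCompact_convexHull ((isCompact_ellipsoid κ n m).image (continuous_momentMap A))

theorem smul_mem_ellipsoid {c : Freq n → ℂ} (hc : c ∈ ellipsoid κ n m) {t : ℂ} (ht : ‖t‖ ≤ 1) :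
    t • c ∈ ellipsoid κ n m := fun F => by
  refine (Finset.sum_le_sum fun a _ => ?_).trans (hc F)
  have hw := zero_le_one.trans (one_le_weight κ m a)
  rw [Pi.smul_apply, norm_smul]
  gcongr
  exact mul_le_of_le_one_left (norm_nonneg _) ht

theorem zero_mem_ellipsoid : (0 : Freq n → ℂ) ∈ ellipsoid κ n m := fun F => by simp

theorem momentMap_smul (t : ℂ) (c : Freq n → ℂ) (k : Fin N) :
    momentMap A (t • c) k = t ^ (A k).card * momentMap A c k := by
  simp [momentMap, Multiset.prod_map_mul]

theorem momentMap_mem_momentHull {c : Freq n → ℂ} (hc : c ∈ ellipsoid κ n m) :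
    momentMap A c ∈ momentHull κ m A :=
  subset_convexHull ℝ _ ⟨c, hc, rfl⟩

theorem mem_pointCone_of_mem_momentHull {p : Fin N → ℂ} (hp : p ∈ momentHull κ m A) :
    p ∈ pointCone κ m A := ⟨1, zero_le_one, p, hp, one_smul ℝ p⟩

theorem zero_mem_pointCone : (0 : Fin N → ℂ) ∈ pointCone κ m A :=
  ⟨0, le_rfl, _, momentMap_mem_momentHull zero_mem_ellipsoid, zero_smul ℝ _⟩

theorem smul_mem_pointCone {t : ℝ} (ht : 0 ≤ t) {z : Fin N → ℂ} (hz : z ∈ pointCone κ m A) :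
    t • z ∈ pointCone κ m A := by
  obtain ⟨s, hs, p, hp, rfl⟩ := hz
  exact ⟨t * s, mul_nonneg ht hs, p, hp, mul_smul t s p⟩

theorem add_mem_pointCone {z w : Fin N → ℂ} (hz : z ∈ pointCone κ m A)
    (hw : w ∈ pointCone κ m A) : z + w ∈ pointCone κ m A := by
  obtain ⟨t, ht, p, hp, rfl⟩ := hz
  obtain ⟨s, hs, q, hq, rfl⟩ := hw
  rcases (add_nonneg ht hs).eq_or_lt with h | h
  · obtain rfl : t = 0 := by linarith
    obtain rfl : s = 0 := by linarith
    simpa using zero_mem_pointCone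
  · refine ⟨t + s, h.le, (t / (t + s)) • p + (s / (t + s)) • q,
      convex_convexHull ℝ _ hp hq (by positivity) (by positivity) (by field_simp), ?_⟩
    rw [smul_add, smul_smul, smul_smul, mul_div_cancel₀ _ h.ne', mul_div_cancel₀ _ h.ne']

theorem sum_mem_pointCone {ι : Type*} (s : Finset ι) {z : ι → Fin N → ℂ}
    (h : ∀ i ∈ s, z i ∈ pointCone κ m A) : ∑ i ∈ s, z i ∈ pointCone κ m A :=
  Finset.sum_induction z (· ∈ pointCone κ m A) (fun _ _ => add_mem_pointCone)
    zero_mem_pointCone h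

/-- A set that contains the moment vectors and is stable under addition and nonnegative scaling
contains the cone. -/
theorem pointCone_subset {X : Set (Fin N → ℂ)}
    (hadd : ∀ z ∈ X, ∀ w ∈ X, z + w ∈ X) (hsmul : ∀ t : ℝ, 0 ≤ t → ∀ z ∈ X, t • z ∈ X)
    (h : ∀ c ∈ ellipsoid κ n m, momentMap A c ∈ X) : pointCone κ m A ⊆ X := by
  rintro _ ⟨t, ht, p, hp, rfl⟩
  refine hsmul t ht p (convexHull_min ?_ ?_ hp)
  · rintro _ ⟨c, hc, rfl⟩
    exact h c hc
  · exact fun z hz w hw a b ha hb _ => hadd _ (hsmul a ha z hz) _ (hsmul b hb w hw)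

/-- If all families are nonempty then the moment cone is symmetric, because the rotations of the
coefficients by roots of unity average all moments to zero. -/
theorem neg_mem_pointCone (hA : ∀ k, A k ≠ 0) {z : Fin N → ℂ} (hz : z ∈ pointCone κ m A) :
    -z ∈ pointCone κ m A := by
  refine pointCone_subset (X := {z | -z ∈ pointCone κ m A}) (fun z hz w hw => ?_)
    (fun t ht z hz => ?_) (fun c hc => ?_) hz
  · rw [Set.mem_ofPred_eq, neg_add]
    exact add_mem_pointCone hz hw
  · rw [Set.mem_ofPred_eq, ← smul_neg]
    exact smul_mem_pointCone ht hz
  -- Every degree lies between $1$ and $d$, so a primitive root of unity of order $d+1$ has no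
  -- trivial power at any of them, and each geometric sum vanishes.
  · set d := ∑ k, (A k).card with hd
    have hζ := Complex.isPrimitiveRoot_exp (d + 1) d.succ_ne_zero
    set ζ := Complex.exp (2 * Real.pi * Complex.I / (d + 1 : ℕ))
    have hnorm : ‖ζ‖ = 1 := hζ.norm'_eq_one d.succ_ne_zero
    have hsum : ∑ j ∈ Finset.range (d + 1), momentMap A (ζ ^ j • c) = 0 := by
      funext k
      have hk : (A k).card ≤ d :=
        Finset.single_le_sum (f := fun k => (A k).card) (fun _ _ => Nat.zero_le _)
          (Finset.mem_univ k)
      have hne : ζ ^ (A k).card ≠ 1 :=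
        hζ.pow_ne_one_of_pos_of_lt (Multiset.card_pos.2 (hA k)).ne' (by omega)
      have h0 : ∑ j ∈ Finset.range (d + 1), (ζ ^ (A k).card) ^ j = 0 := by
        rw [geom_sum_eq hne, ← pow_mul, mul_comm, pow_mul, hζ.pow_eq_one, one_pow, sub_self,
          zero_div]
      rw [Finset.sum_apply, Pi.zero_apply]
      simp_rw [momentMap_smul, ← pow_mul, mul_comm _ (A k).card, pow_mul]
      rw [← Finset.sum_mul, h0, zero_mul]
    -- Splitting off $j=0$ exhibits the negative of the moment vector as the sum over the other
    -- rotations.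
    rw [Finset.sum_range_succ', pow_zero, one_smul] at hsum
    rw [Set.mem_ofPred_eq, ← eq_neg_of_add_eq_zero_left hsum]
    refine sum_mem_pointCone _ fun j _ => mem_pointCone_of_mem_momentHull
      (momentMap_mem_momentHull (smul_mem_ellipsoid hc ?_))
    rw [norm_pow, hnorm, one_pow]

/-- If all families are nonempty, symmetry makes the cone a real subspace of a finite-dimensional
space. If some family is empty, its coordinate equals $1$ on the compact hull, so the scaling factor
is controlled by the norm of the vector. -/
theorem isClosed_pointCone : IsClosed (pointCone κ m A) := by
  by_cases hA : ∀ k, A k ≠ 0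
  · let S : Submodule ℝ (Fin N → ℂ) :=
      { carrier := pointCone κ m A
        add_mem' := add_mem_pointCone
        zero_mem' := zero_mem_pointCone
        smul_mem' := fun t z hz => by
          rcases le_total 0 t with ht | ht
          · exact smul_mem_pointCone ht hz
          · rw [← neg_neg (t • z), ← neg_smul]
            exact neg_mem_pointCone hA (smul_mem_pointCone (neg_nonneg.2 ht) hz) }
    exact S.closed_of_finiteDimensional
  · push Not at hA
    obtain ⟨k, hk⟩ := hA
    have hone {p : Fin N → ℂ} (hp : p ∈ momentHull κ m A) : p k = 1 := by
      refine convexHull_min (t := {p | p k = 1}) ?_ ?_ hp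
      · rintro _ ⟨c, -, rfl⟩
        simp [momentMap, hk]
      · exact (convex_singleton (1 : ℂ)).linear_preimage
          (LinearMap.proj k : (Fin N → ℂ) →ₗ[ℝ] ℂ)
    refine isClosed_of_closure_subset fun z hz => ?_
    let T : Set (Fin N → ℂ) :=
      (fun q : ℝ × (Fin N → ℂ) => q.1 • q.2) '' (Set.Icc 0 (‖z‖ + 1) ×ˢ momentHull κ m A)
    have hT : IsCompact T := (isCompact_Icc.prod isCompact_momentHull).image (by fun_prop)
    have hzT : z ∈ closure T := by
      have h1 : z ∈ closure (Metric.ball z 1 ∩ pointCone κ m A) :=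
        Metric.isOpen_ball.inter_closure ⟨Metric.mem_ball_self one_pos, hz⟩
      refine closure_mono ?_ h1
      rintro _ ⟨hb, t, ht, p, hp, rfl⟩
      refine ⟨(t, p), ⟨⟨ht, ?_⟩, hp⟩, rfl⟩
      have h2 := norm_le_pi_norm (t • p) k
      rw [Pi.smul_apply, hone hp, norm_smul, Real.norm_of_nonneg ht, norm_one, mul_one] at h2
      rw [Metric.mem_ball, dist_eq_norm] at hb
      have h3 := norm_sub_norm_le (t • p) z
      linarith
    rw [hT.isClosed.closure_eq] at hzT
    obtain ⟨⟨t, p⟩, ⟨ht, hp⟩, rfl⟩ := hzT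
    exact ⟨t, ht.1, p, hp, rfl⟩

theorem outerCone_subset_pointCone :
    outerCone (quadraticModuleTop κ n m) A ⊆ pointCone κ m A := by
  rintro z ⟨y, -, hy, hz⟩
  rw [← isPositive_rieszMap_iff] at hy
  obtain rfl : z = fun k => y (exponent (A k)) := funext hz
  have h1 := hy.map_one_eq
  have h0 := (Complex.le_def.1 hy.map_one_nonneg).1
  rw [rieszMap_one] at h1 h0
  set t := (y 0).re
  rw [Complex.zero_re] at h0
  rcases h0.eq_or_lt with h | h
  · rw [← h, Complex.ofReal_zero, ← rieszMap_one y] at h1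
    have hy0 : y = 0 := funext fun s => by rw [← rieszMap_monomial y s, hy.eq_zero h1]; rfl
    rw [hy0]
    exact zero_mem_pointCone
  · have hne : (t : ℂ) ≠ 0 := by exact_mod_cast h.ne'
    have hs : ((t⁻¹ : ℝ) : ℂ) • y ∈ states κ n m := by
      refine ⟨?_, ?_⟩
      · rw [rieszMap_smul]
        exact hy.smul (inv_nonneg.2 h0)
      · rw [Pi.smul_apply, h1, smul_eq_mul, Complex.ofReal_inv, inv_mul_cancel₀ hne]
    have := mem_closure_of_mem_states A hs
    rw [show closure (convexHull ℝ (momentMap A '' ellipsoid κ n m)) = momentHull κ m A from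
      (isCompact_momentHull (κ := κ) (m := m) (A := A)).isClosed.closure_eq] at this
    refine ⟨t, h0, _, this, funext fun k => ?_⟩
    rw [Pi.smul_apply, Pi.smul_apply, Complex.real_smul, smul_eq_mul, Complex.ofReal_inv,
      mul_inv_cancel_left₀ hne]

end Cone

/-! ### Point evaluations and the outer cone -/

section Evaluation

variable {κ : SobolevNorm} {n m N : ℕ} {A : Fin N → Multiset (Freq n)}

/-- The values of the variables at a family of coefficients. -/
def varValue (c : Freq n → ℂ) (v : Var n) : ℂ := Sum.elim c (fun a => conj (c a)) v

/-- Evaluation of polynomials at a family of coefficients. -/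
def evalAt (c : Freq n → ℂ) : Poly n →ₐ[ℂ] ℂ := MvPolynomial.aeval (varValue c)

theorem evalAt_conjPoly (c : Freq n → ℂ) (q : Poly n) :
    evalAt c (conjPoly q) = conj (evalAt c q) := by
  induction q using MvPolynomial.induction_on with
  | C z => simp [conjPoly_C, evalAt]
  | add p q hp hq => rw [conjPoly_add, map_add, hp, hq, map_add, map_add]
  | mul_X p v hp =>
    rw [conjPoly_mul, map_mul, hp, map_mul, map_mul, conjPoly_X]
    congr 1
    rcases v with a | a <;> simp [evalAt, varValue]

theorem isPositive_evalAt {c : Freq n → ℂ} (hc : c ∈ ellipsoid κ n m) :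
    IsPositive κ m (evalAt c).toLinearMap := by
  have hsq (q : Poly n) : evalAt c (hermSq q) = ((‖evalAt c q‖ ^ 2 : ℝ) : ℂ) := by
    rw [hermSq, map_mul, evalAt_conjPoly, Complex.conj_mul', Complex.ofReal_pow]
  intro q F
  have e : evalAt c (ellipsoidPolyOn κ m F) =
      ((1 - ∑ a ∈ F, κ.weight m a * ‖c a‖ ^ 2 : ℝ) : ℂ) := by
    rw [ellipsoidPolyOn, map_sub, map_one, map_sum]
    push_cast
    congr 1
    refine Finset.sum_congr rfl fun a _ => ?_
    rw [map_mul, hsq]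
    simp [evalAt, varValue]
  rw [AlgHom.toLinearMap_apply, map_mul, hsq, e, ← Complex.ofReal_mul]
  exact_mod_cast mul_nonneg (by positivity) (sub_nonneg.2 (hc F))

theorem evalAt_monomial (c : Freq n → ℂ) (s : Var n →₀ ℕ) :
    evalAt c (MvPolynomial.monomial s 1) = s.prod fun v k => varValue c v ^ k := by
  simp [evalAt, MvPolynomial.aeval_monomial]

/-- The monomials in a summable family of nonnegative numbers bounded away from one are summable. -/
theorem summable_finsupp_prod {ι : Type*} {r : ι → ℝ} {ρ C : ℝ} (h0 : ∀ i, 0 ≤ r i)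
    (hρ : ∀ i, r i ≤ ρ) (hρ1 : ρ < 1) (hC : ∀ F : Finset ι, ∑ i ∈ F, r i ≤ C) :
    Summable fun s : ι →₀ ℕ => s.prod fun i k => r i ^ k := by
  classical
  have hnn (s : ι →₀ ℕ) : 0 ≤ s.prod fun i k => r i ^ k :=
    Finset.prod_nonneg fun i _ => pow_nonneg (h0 i) _
  refine summable_of_sum_le (c := Real.exp (C / (1 - ρ))) hnn fun G => ?_
  have hd : 0 < 1 - ρ := sub_pos.2 hρ1
  set F := G.sup fun s => s.support with hF
  set D := G.sup fun s => F.sup s with hD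
  have hsupp {s : ι →₀ ℕ} (hs : s ∈ G) : s.support ⊆ F :=
    Finset.le_sup (f := fun s : ι →₀ ℕ => s.support) hs
  let e : (ι →₀ ℕ) → (i : ι) → i ∈ F → ℕ := fun s i _ => s i
  have hinj : Set.InjOn e G := by
    intro s hs t ht hst
    ext i
    by_cases hi : i ∈ F
    · exact congrFun (congrFun hst i) hi
    · rw [Finsupp.notMem_support_iff.1 fun h => hi (hsupp hs h),
        Finsupp.notMem_support_iff.1 fun h => hi (hsupp ht h)]
  -- Finitely many monomials fit into a box of exponents, where the sum factors into truncated
  -- geometric series. Each factor is at most $1/(1-r_i)\le 1+r_i/(1-\rho)\le e^{r_i/(1-\rho)}$.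
  calc ∑ s ∈ G, (s.prod fun i k => r i ^ k)
      = ∑ s ∈ G, ∏ i ∈ F.attach, r i ^ e s i i.2 := by
        refine Finset.sum_congr rfl fun s hs => ?_
        rw [Finsupp.prod_of_support_subset s (hsupp hs) _ fun i _ => pow_zero _,
          ← Finset.prod_attach]
    _ = ∑ p ∈ G.image e, ∏ i ∈ F.attach, r i ^ p i i.2 := by
        rw [Finset.sum_image hinj]
    _ ≤ ∑ p ∈ F.pi fun _ => Finset.range (D + 1), ∏ i ∈ F.attach, r i ^ p i i.2 := by
        refine Finset.sum_le_sum_of_subset_of_nonneg (fun p hp => ?_)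
          fun p _ _ => Finset.prod_nonneg fun i _ => pow_nonneg (h0 i) _
        obtain ⟨s, hs, rfl⟩ := Finset.mem_image.1 hp
        refine Finset.mem_pi.2 fun i hi => Finset.mem_range.2 (Nat.lt_succ_of_le ?_)
        exact (Finset.le_sup (f := s) hi).trans
          (Finset.le_sup (f := fun s : ι →₀ ℕ => F.sup s) hs)
    _ = ∏ i ∈ F, ∑ k ∈ Finset.range (D + 1), r i ^ k :=
        (Finset.prod_sum F (fun _ => Finset.range (D + 1)) fun i k => r i ^ k).symm
    _ ≤ ∏ i ∈ F, Real.exp (r i / (1 - ρ)) := by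
        refine Finset.prod_le_prod
          (fun i _ => Finset.sum_nonneg fun k _ => pow_nonneg (h0 i) k) fun i _ => ?_
        have hi : r i < 1 := (hρ i).trans_lt hρ1
        have hi' : 0 < 1 - r i := sub_pos.2 hi
        calc ∑ k ∈ Finset.range (D + 1), r i ^ k ≤ (1 - r i)⁻¹ := by
              rw [← tsum_geometric_of_lt_one (h0 i) hi]
              exact (summable_geometric_of_lt_one (h0 i) hi).sum_le_tsum _
                fun k _ => pow_nonneg (h0 i) k
          _ = r i / (1 - r i) + 1 := by field_simp; ring
          _ ≤ r i / (1 - ρ) + 1 := by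
              gcongr
              · exact h0 i
              · exact hρ i
          _ ≤ _ := Real.add_one_le_exp _
    _ = Real.exp ((∑ i ∈ F, r i) / (1 - ρ)) := by rw [← Real.exp_sum, Finset.sum_div]
    _ ≤ Real.exp (C / (1 - ρ)) := by gcongr; exact hC F

theorem norm_varValue (c : Freq n → ℂ) (v : Var n) : ‖varValue c v‖ = ‖c v.freq‖ := by
  rcases v with a | a <;> simp [varValue, Var.freq]

/-- The bound is $2$ because each frequency carries two variables, $c_a$ and $\bar c_a$. -/
theorem sum_norm_varValue_sq_le {c : Freq n → ℂ} (hc : c ∈ ellipsoid κ n m)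
    (F : Finset (Var n)) : ∑ v ∈ F, ‖varValue c v‖ ^ 2 ≤ 2 := by
  classical
  have h : F ⊆ (F.image Var.freq).disjSum (F.image Var.freq) := by
    rintro (a | a) hv
    · exact Finset.inl_mem_disjSum.2 (Finset.mem_image.2 ⟨_, hv, rfl⟩)
    · exact Finset.inr_mem_disjSum.2 (Finset.mem_image.2 ⟨_, hv, rfl⟩)
  refine (Finset.sum_le_sum_of_subset_of_nonneg h fun _ _ _ => by positivity).trans ?_
  rw [Finset.sum_disjSum]
  simp only [norm_varValue, Var.freq, Sum.elim_inl, Sum.elim_inr, id]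
  linarith [norm_sq_le_of_mem_ellipsoid hc (F.image Var.freq)]

/-- Shrinking is needed since $|c_0|=1$ can occur, and then all powers of $c_0$ have modulus one.
After scaling, every variable has squared modulus at most $t^2<1$, so the monomial values are square
summable. -/
theorem momentMap_smul_mem_outerCone {c : Freq n → ℂ} (hc : c ∈ ellipsoid κ n m) {t : ℝ}
    (ht0 : 0 ≤ t) (ht1 : t < 1) :
    momentMap A ((t : ℂ) • c) ∈ outerCone (quadraticModuleTop κ n m) A := by
  have htn : ‖(t : ℂ)‖ = t := by rw [Complex.norm_real, Real.norm_of_nonneg ht0]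
  have htc := smul_mem_ellipsoid hc (t := t) (by rw [htn]; exact ht1.le)
  refine ⟨fun s => (evalAt ((t : ℂ) • c)).toLinearMap (MvPolynomial.monomial s 1), ?_, ?_, ?_⟩
  · refine memℓp_gen ?_
    have hs := summable_finsupp_prod (r := fun v => ‖varValue ((t : ℂ) • c) v‖ ^ 2) (ρ := t ^ 2)
      (C := 2) (fun v => by positivity) (fun v => ?_)
      (pow_lt_one₀ ht0 ht1 two_ne_zero) (sum_norm_varValue_sq_le htc)
    · refine hs.congr fun s => ?_
      rw [AlgHom.toLinearMap_apply, evalAt_monomial, Finsupp.prod, Finsupp.prod, norm_prod,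
        ENNReal.toReal_ofNat, Real.rpow_ofNat, ← Finset.prod_pow]
      simp only [norm_pow, ← pow_mul, mul_comm]
    · rw [norm_varValue, Pi.smul_apply, norm_smul, htn]
      exact pow_le_pow_left₀ (by positivity)
        (mul_le_of_le_one_right ht0 (norm_le_one_of_mem_ellipsoid hc _)) 2
  · rw [← isPositive_rieszMap_iff, rieszMap_of_linearMap]
    exact isPositive_evalAt htc
  · intro k
    beta_reduce
    rw [AlgHom.toLinearMap_apply, monomial_exponent, map_multiset_prod, Multiset.map_map, momentMap]
    congr 1
    refine Multiset.map_congr rfl fun a _ => ?_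
    simp [evalAt, varValue]

theorem pointCone_subset_closure_outerCone :
    pointCone κ m A ⊆ closure (outerCone (quadraticModuleTop κ n m) A) := by
  set X := outerCone (quadraticModuleTop κ n m) A with hX
  have hadd : ∀ z ∈ X, ∀ w ∈ X, z + w ∈ X := by
    rintro z ⟨y, hy, hp, hz⟩ w ⟨x, hx, hp', hw⟩
    refine ⟨y + x, hy.add hx, ?_, fun k => by rw [Pi.add_apply, hz, hw, Pi.add_apply]⟩
    rw [← isPositive_rieszMap_iff] at hp hp' ⊢
    rw [rieszMap_add]
    exact fun q F => add_nonneg (hp q F) (hp' q F)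
  have hsmul : ∀ t : ℝ, 0 ≤ t → ∀ z ∈ X, t • z ∈ X := by
    rintro t ht z ⟨y, hy, hp, hz⟩
    refine ⟨(t : ℂ) • y, hy.const_smul _, ?_, fun k => by
      rw [Pi.smul_apply, hz, Pi.smul_apply, Complex.real_smul, smul_eq_mul]⟩
    rw [← isPositive_rieszMap_iff] at hp ⊢
    rw [rieszMap_smul]
    exact hp.smul ht
  refine pointCone_subset (fun z hz w hw => ?_) (fun t ht z hz => ?_) fun c hc => ?_
  · exact map_mem_closure₂ continuous_add hz hw hadd
  · exact map_mem_closure (continuous_const_smul t) hz (hsmul t ht)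
  · have hcont : Continuous fun t : ℝ => momentMap A ((t : ℂ) • c) :=
      (continuous_momentMap A).comp (by fun_prop)
    have hlim : Tendsto (fun t : ℝ => momentMap A ((t : ℂ) • c)) (𝓝[<] 1) (𝓝 (momentMap A c)) := by
      have := (hcont.tendsto 1).mono_left (nhdsWithin_le_nhds (s := Set.Iio 1))
      rwa [Complex.ofReal_one, one_smul] at this
    refine mem_closure_of_tendsto hlim ?_
    filter_upwards [Ioo_mem_nhdsLT (zero_lt_one' ℝ)] with t ht
    exact momentMap_smul_mem_outerCone hc ht.1.le ht.2

end Evaluation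

/-! ### Measures on the ball -/

section Measures

variable {κ : SobolevNorm} {n m N : ℕ} {A : Fin N → Multiset (Freq n)}

theorem innerRegular_dirac {X : Type*} [TopologicalSpace X] [MeasurableSpace X] (x : X) :
    (Measure.dirac x).InnerRegular := by
  refine ⟨fun U hU r hr => ?_⟩
  have hx : x ∈ U := by
    by_contra hx
    simp [Measure.dirac_apply' x hU, hx] at hr
  refine ⟨{x}, Set.singleton_subset_iff.2 hx, isCompact_singleton, hr.trans_le ?_⟩
  rw [Measure.dirac_apply_of_mem (Set.mem_singleton x)]
  exact prob_le_one

/-- A locally finite measure carried by the ball is finite, as the closure of the ball in $L^2$ is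
compact; restricting the integral to the ball then changes nothing. -/
theorem mem_momentCone_iff (hm : 0 < m) {y : Fin N → ℂ} :
    y ∈ momentCone κ m A ↔ ∃ μ : Measure (L2 n), IsFiniteMeasure μ ∧ μ.InnerRegular ∧
      (∀ᵐ f ∂μ, f ∈ ball κ n m) ∧ ∀ k, y k = ∫ f, momentMap A (coeff f) k ∂μ := by
  constructor
  · rintro ⟨μ, hμ, hreg, h0, hy⟩
    have hae : ∀ᵐ f ∂μ, f ∈ ball κ n m := h0
    refine ⟨μ, ⟨?_⟩, hreg, hae, fun k => ?_⟩
    · rw [← Set.union_compl_self (ball κ n m)]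
      refine (measure_union_le _ _).trans_lt ?_
      rw [h0, add_zero]
      exact measure_ball_lt_top κ n hm μ
    · rw [hy, Measure.restrict_eq_self_of_ae_mem hae]
      rfl
  · rintro ⟨μ, hμ, hreg, hae, hy⟩
    refine ⟨μ, inferInstance, hreg, hae, fun k => ?_⟩
    rw [hy, Measure.restrict_eq_self_of_ae_mem hae]
    rfl

theorem continuous_momentMap_coeff (A : Fin N → Multiset (Freq n)) :
    Continuous fun f : L2 n => momentMap A (coeff f) :=
  (continuous_momentMap A).comp (continuous_pi continuous_coeff)

theorem integrable_momentMap_coeff {μ : Measure (L2 n)} [IsFiniteMeasure μ] [μ.InnerRegular]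
    (h : ∀ᵐ f ∂μ, f ∈ ball κ n m) :
    Integrable (fun f => momentMap A (coeff f)) μ := by
  obtain ⟨C, hC⟩ := ((isCompact_ellipsoid κ n m).image
    (continuous_momentMap A)).isBounded.exists_norm_le
  refine Integrable.of_bound (continuous_momentMap_coeff A).aestronglyMeasurable C ?_
  filter_upwards [h] with f hf
  exact hC _ ⟨_, mem_ball_iff.1 hf, rfl⟩

theorem pointCone_subset_momentCone (hm : 0 < m) : pointCone κ m A ⊆ momentCone κ m A := by
  refine pointCone_subset (fun z hz w hw => ?_) (fun t ht z hz => ?_) fun c hc => ?_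
  · rw [mem_momentCone_iff hm] at hz hw ⊢
    obtain ⟨μ, hμ, hreg, hae, hz⟩ := hz
    obtain ⟨ν, hν, hreg', hae', hw⟩ := hw
    refine ⟨μ + ν, inferInstance, inferInstance, ae_add_measure_iff.2 ⟨hae, hae'⟩, fun k => ?_⟩
    rw [Pi.add_apply, hz, hw, integral_add_measure ((integrable_momentMap_coeff hae).eval k)
      ((integrable_momentMap_coeff hae').eval k)]
  · rw [mem_momentCone_iff hm] at hz ⊢
    obtain ⟨μ, hμ, hreg, hae, hz⟩ := hz
    refine ⟨t.toNNReal • μ, inferInstance, inferInstance, ?_, fun k => ?_⟩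
    · exact Measure.ae_smul_measure hae _
    · rw [Pi.smul_apply, hz, integral_smul_nnreal_measure, NNReal.smul_def,
        Real.coe_toNNReal t ht]
  · obtain ⟨f, hf, rfl⟩ := exists_mem_ball_coeff_eq hc
    refine (mem_momentCone_iff hm).2 ⟨Measure.dirac f, inferInstance, innerRegular_dirac f, ?_,
      fun k => ?_⟩
    · rw [ae_dirac_eq]
      exact hf
    · rw [integral_dirac]

theorem momentCone_subset_pointCone (hm : 0 < m) : momentCone κ m A ⊆ pointCone κ m A := by
  intro y hy
  obtain ⟨μ, hμ, hreg, hae, hy⟩ := (mem_momentCone_iff hm).1 hy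
  have hint := integrable_momentMap_coeff (A := A) hae
  have hy' : y = ∫ f, momentMap A (coeff f) ∂μ :=
    funext fun k => by rw [hy, eval_integral fun k => hint.eval k]
  rcases eq_or_ne μ 0 with rfl | hne
  · rw [hy', integral_zero_measure]
    exact zero_mem_pointCone
  · have : NeZero μ := ⟨hne⟩
    -- The integral is the total mass times the mean, and the mean lies in the closed convex set
    -- `momentHull`.
    refine ⟨μ.real Set.univ, measureReal_nonneg, ⨍ f, momentMap A (coeff f) ∂μ,
      (convex_convexHull ℝ _).average_mem isCompact_momentHull.isClosed ?_ hint, ?_⟩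
    · filter_upwards [hae] with f hf
      exact momentMap_mem_momentHull (mem_ball_iff.1 hf)
    · rw [hy', measure_smul_average]

theorem closure_outerCone_eq_momentCone (hm : 0 < m) :
    closure (outerCone (quadraticModuleTop κ n m) A) = momentCone κ m A :=
  Set.Subset.antisymm
    ((closure_minimal outerCone_subset_pointCone isClosed_pointCone).trans
      (pointCone_subset_momentCone hm))
    ((momentCone_subset_pointCone hm).trans pointCone_subset_closure_outerCone)

end Measures

end SobolevMoment

end

theorem mainTheorem3 (n m N : ℕ) (hn : 0 < n) (hm : 0 < m) (κ : SobolevMoment.SobolevNorm)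
    (A : Fin N → Multiset (Fin n → ℤ)) :
    closure (SobolevMoment.outerCone (SobolevMoment.quadraticModuleTop κ n m) A) =
      SobolevMoment.momentCone κ m A :=
  SobolevMoment.closure_outerCone_eq_momentCone hm
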